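/- **Setting.** Let $\mathcal C$ be a triangulated persistence category over a field $\mathbf k$. That is: the morphisms $A\to B$ form persistence $\mathbf k$-modules $r\mapsto \hom^r_{\mathcal C}(A,B)$, $r\in\mathbb R$, with structure maps $i_{r,s}$ for $r\le s$; composition is bilinear, adds shifts and is compatible with the $i_{r,s}$; there is a shift functor, i.e. a monoidal functor $r\mapsto\Sigma^r$ to persistence endofunctors with natural isomorphisms $\eta_{r,s}:\Sigma^r\to\Sigma^s$ of shift $s-r$; the category $\mathcal C_0$ (same objects, morphisms $\hom^0$) is triangulated with translation $T$, where $T$ extends to a persistence functor of $\mathcal C$ and each $\Sigma^r$ is a triangulated functor of $\mathcal C_0$; and for all $r\ge0$ the morphism $\eta^A_r=i_{-r,0}((\eta_{r,0})_A):\Sigma^rA\to A$ has an $r$-acyclic cone in $\mathcal C_0$, where $K$ is $r$-acyclic if $i_{0,r}(\mathbb 1_K)=0$. Let $\mathcal{AC}_0\subset\mathcal C_0$ be the full subcategory of objects that are $r$-acyclic for some $r\ge 0$, and let $\mathcal C_\infty$ have the objects of $\mathcal C$ and morphisms $\varinjlim_{r\to\infty}\hom^r_{\mathcal C}(A,B)$;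 write $[f]$ for the class of $f$. The zero object $0$ and direct sums are those of $\mathcal C_0$. A morphism of $\mathcal C_0$ is an *$r$-isomorphism* if it has an $r$-acyclic cone. A *strict exact triangle of weight $r\ge0$* is a diagram $A\xrightarrow{\bar u}B\xrightarrow{\bar v}C\xrightarrow{\bar w}\Sigma^{-r}TA$ in $\mathcal C_0$ for which there are an exact triangle $A\xrightarrow{\bar u}B\xrightarrow{v}C'\xrightarrow{w}TA$ in $\mathcal C_0$, an $r$-isomorphism $\phi:C'\to C$ and $\psi:\Sigma^rC\to C'$ with $\phi\psi=\eta_r^C$, $\phi v=\bar v$, $w\psi=\Sigma^r\bar w$. For an exact triangle $\Delta:A\xrightarrow{u}B\xrightarrow{v}C\xrightarrow{w}TA$ in $\mathcal C_\infty$ let $w_\infty(\Delta)$ be the infimum of the weights $r$ of strict exact triangles $A\to\Sigma^{-q}B\to\Sigma^{-s}C\to\Sigma^{-r}TA$ with $0\le q\le s\le r$ whose classes in $\mathcal C_\infty$ become $u,v,w$ after identifying $\Sigma^{-q}B$, $\Sigma^{-s}C$, $\Sigma^{-r}TA$ with $B$, $C$, $TA$ through $\eta$; and let $$\bar w(\Delta)=\inf_{t\ge0}w_\infty(\Sigma^{t,0,0,t}\Delta),\qquad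 \Sigma^{t,0,0,t}\Delta:\ \Sigma^tA\to B\to C\to T\Sigma^tA .$$ Say that $\bar w(\Delta)$ is *attained* if it equals the weight of one of the strict exact triangles occurring in these infima. **Theorem.** The functor $\mathcal C_0\to\mathcal C_\infty$, $f\mapsto[f]$, exhibits $\mathcal C_\infty$ as the Verdier quotient $\mathcal C_0/\mathcal{AC}_0$. With the resulting triangulated structure, whose exact triangles are those isomorphic to images of exact triangles of $\mathcal C_0$, $\bar w$ is a subadditive triangular weight on $\mathcal C_\infty$ with $\bar w_0=0$. Precisely: 1. $\bar w(\Delta)\in[0,\infty)$ for every exact triangle $\Delta$ of $\mathcal C_\infty$. 2. (Weighted octahedral axiom.) Let $\Delta_1:A\to B\to C\to TA$ and $\Delta_2:C\to D\to E\to TC$ be exact in $\mathcal C_\infty$. For every $\varepsilon>0$ there are exact triangles $\Delta_3:B\to D\to F\to TB$ and $\Delta_4:TA\to F\to E\to T^2A$ making the diagram $$\begin{array}{ccccccc}A&\to&0&\to&TA&\to&TA\\ \downarrow&&\downarrow&&\downarrow&&\downarrow\\ B&\to&D&\to&F&\to&TB\\ \downarrow&&\downarrow&&\downarrow&&\downarrow\\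 C&\to&D&\to&E&\to&TC\\ \downarrow&&\downarrow&&\downarrow&&\downarrow\\ TA&\to&0&\to&T^2A&\to&T^2A\end{array}$$ commute, except for the bottom right square, which anti-commutes (the middle rows are $\Delta_3,\Delta_2$; the first and third columns are $\Delta_1,\Delta_4$; the last column is $T\Delta_1$ without sign; maps $TA\to TA$, $D\to D$, $T^2A\to T^2A$ are identities), and such that $\bar w(\Delta_3)+\bar w(\Delta_4)\le\bar w(\Delta_1)+\bar w(\Delta_2)+\varepsilon$. If $\bar w(\Delta_1)$ and $\bar w(\Delta_2)$ are attained, there are such $\Delta_3,\Delta_4$ with $\bar w(\Delta_3)+\bar w(\Delta_4)\le\bar w(\Delta_1)+\bar w(\Delta_2)$. 3. (Normalization.) $\bar w(\Delta)=0$ for $\Delta: 0\to X\xrightarrow{\mathbb 1}X\to0$ and all its rotations. If $B=0$ in 2, then $\Delta_3$ can be taken to be $0\to D\xrightarrow{\mathbb 1}D\to0$, with $\bar w(\Delta_3)+\bar w(\Delta_4)\le\bar w(\Delta_1)+\bar w(\Delta_2)$. 4. (Subadditivity.) For every exact $\Delta:A\to B\to C\to TA$ in $\mathcal C_\infty$ and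 every object $X$, the triangles $X\oplus\Delta:A\to X\oplus B\to X\oplus C\to TA$ and $\Delta\oplus X:A\to B\oplus X\to C\oplus X\to TA$ are exact, and $\bar w(X\oplus\Delta)\le\bar w(\Delta)$, $\bar w(\Delta\oplus X)\le\bar w(\Delta)$. -/

import Mathlib

open CategoryTheory CategoryTheory.Limits CategoryTheory.Pretriangulated
open scoped ENNReal NNReal

universe w v u

/-! ## Persistence categories -/

/-- A persistence category over the field `k`: for all objects `A`, `B` a persistence `k`-module
`r ↦ Hom r A B` (with structure maps `incl : Hom r A B → Hom s A B` for `r ≤ s`), identities of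
shift `0`, and a bilinear composition `Hom r A B × Hom s B C → Hom (r + s) A C`, written in
diagrammatic order, which is compatible with the structure maps.  The unit and associativity laws
hold up to the (identity) structure maps `incl` between the equal levels `0 + r`, `r + 0`, `r` and
`(r + s) + t`, `r + (s + t)`. -/
class PersistenceCategory (k : Type w) [Field k] (C : Type u) where
  Hom : ℝ → C → C → Type v
  [addCommGroup : ∀ r A B, AddCommGroup (Hom r A B)]
  [module : ∀ r A B, Module k (Hom r A B)]
  incl : ∀ {r s : ℝ} (_ : r ≤ s) {A B : C}, Hom r A B →ₗ[k] Hom s A B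
  incl_refl : ∀ {r : ℝ} {A B : C} (f : Hom r A B), incl le_rfl f = f
  incl_incl : ∀ {r s t : ℝ} (h : r ≤ s) (h' : s ≤ t) {A B : C} (f : Hom r A B),
    incl h' (incl h f) = incl (h.trans h') f
  ident : ∀ A : C, Hom 0 A A
  comp : ∀ {r s : ℝ} {A B D : C}, Hom r A B →ₗ[k] Hom s B D →ₗ[k] Hom (r + s) A D
  incl_comp : ∀ {r r' s s' : ℝ} (h : r ≤ r') (h' : s ≤ s') {A B D : C}
    (f : Hom r A B) (g : Hom s B D),
    incl (add_le_add h h') (comp f g) = comp (incl h f) (incl h' g)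
  ident_comp : ∀ {r : ℝ} {A B : C} (f : Hom r A B),
    comp (ident A) f = incl (zero_add r).ge f
  comp_ident : ∀ {r : ℝ} {A B : C} (f : Hom r A B),
    comp f (ident B) = incl (add_zero r).ge f
  comp_assoc : ∀ {r s t : ℝ} {A B D E : C} (f : Hom r A B) (g : Hom s B D) (h : Hom t D E),
    comp (comp f g) h = incl (add_assoc r s t).ge (comp f (comp g h))

namespace PersistenceCategory

attribute [reducible, instance] addCommGroup module

variable {k : Type w} [Field k] {C : Type u} [PersistenceCategory.{w, v, u} k C]

theorem comp_incl_left {r r' s : ℝ} (h : r ≤ r') {A B D : C} (f : Hom k r A B) (g : Hom k s B D) :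
    comp (incl h f) g = incl (add_le_add h le_rfl) (comp f g) := by
  rw [incl_comp h le_rfl, incl_refl]

theorem comp_incl_right {r s s' : ℝ} (h : s ≤ s') {A B D : C} (f : Hom k r A B)
    (g : Hom k s B D) :
    comp f (incl h g) = incl (add_le_add le_rfl h) (comp f g) := by
  rw [incl_comp le_rfl h, incl_refl]

end PersistenceCategory

open PersistenceCategory

/-! ## The `0`-level and the limit category -/

/-- The objects of the `0`-level category `C₀` of a persistence category: those of `C`. -/
structure Level0 (k : Type w) (C : Type u) : Type u where
  as : C

/-- The objects of the limit category `C_∞` of a persistence category: those of `C`. -/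
structure LevelInf (k : Type w) (C : Type u) : Type u where
  as : C

section Levels

variable (k : Type w) [Field k] (C : Type u) [PersistenceCategory.{w, v, u} k C]

/-- The `0`-level category: morphisms are the morphisms of shift `0`. -/
instance : Category (Level0 k C) where
  Hom A B := PersistenceCategory.Hom k 0 A.as B.as
  id A := ident A.as
  comp f g := incl (add_zero (0 : ℝ)).le (PersistenceCategory.comp f g)
  id_comp f := by
    rw [ident_comp, incl_incl, incl_refl]
  comp_id f := by
    rw [comp_ident, incl_incl, incl_refl]
  assoc f g h := by
    rw [comp_incl_left, comp_incl_right, comp_assoc]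
    simp only [incl_incl]

instance : Preadditive (Level0 k C) where
  homGroup A B := inferInstanceAs (AddCommGroup (PersistenceCategory.Hom k 0 A.as B.as))
  add_comp A B D f f' g := by
    change PersistenceCategory.Hom k 0 A.as B.as at f f'
    change PersistenceCategory.Hom k 0 B.as D.as at g
    change incl (add_zero (0 : ℝ)).le (PersistenceCategory.comp (f + f') g) =
      incl (add_zero (0 : ℝ)).le (PersistenceCategory.comp f g) +
        incl (add_zero (0 : ℝ)).le (PersistenceCategory.comp f' g)
    rw [map_add, LinearMap.add_apply, map_add]
  comp_add A B D f g g' := by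
    change PersistenceCategory.Hom k 0 A.as B.as at f
    change PersistenceCategory.Hom k 0 B.as D.as at g g'
    change incl (add_zero (0 : ℝ)).le (PersistenceCategory.comp f (g + g')) =
      incl (add_zero (0 : ℝ)).le (PersistenceCategory.comp f g) +
        incl (add_zero (0 : ℝ)).le (PersistenceCategory.comp f g')
    rw [map_add, map_add]

variable {k C}

/-- A morphism of shift `0`, as a morphism of `C₀`. -/
def toZero {A B : C} (f : Hom k 0 A B) : (⟨A⟩ : Level0 k C) ⟶ ⟨B⟩ := f

/-- A morphism of `C₀`, as a morphism of shift `0`. -/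
def ofZero {A B : Level0 k C} (f : A ⟶ B) : Hom k 0 A.as B.as := f

/-- The persistence module `r ↦ Hom r A B`, as a directed system indexed by `ℝ`. -/
instance (A B : C) :
    DirectedSystem (fun r : ℝ => Hom k r A B) (fun _ _ h => incl (k := k) (A := A) (B := B) h) where
  map_self _ f := incl_refl f
  map_map _ _ _ h h' f := incl_incl h h' f

/-- The morphisms `A ⟶ B` of `C_∞`: the direct limit of the `Hom r A B` for `r → ∞`. -/
abbrev HomInf (k : Type w) [Field k] {C : Type u} [PersistenceCategory.{w, v, u} k C]
    (A B : C) : Type v :=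
  DirectLimit (fun r : ℝ => Hom k r A B) (fun _ _ h => incl (k := k) (A := A) (B := B) h)

/-- The class `[f]` in the direct limit of a morphism `f` of shift `r`. -/
def cls {r : ℝ} {A B : C} (f : Hom k r A B) : HomInf k A B := ⟦⟨r, f⟩⟧

theorem cls_incl {r s : ℝ} (h : r ≤ s) {A B : C} (f : Hom k r A B) :
    cls (incl h f) = cls f :=
  DirectLimit.mk_apply (F := fun r : ℝ => Hom k r A B)
    (f := fun _ _ h => incl (k := k) (A := A) (B := B) h) r s f h

theorem exists_cls {A B : C} (φ : HomInf k A B) :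
    ∃ (r : ℝ) (_ : 0 ≤ r) (f : Hom k r A B), φ = cls f := by
  obtain ⟨r, f, rfl⟩ := DirectLimit.exists_eq_mk _ φ
  exact ⟨max r 0, le_max_right _ _, incl (le_max_left _ _) f, (cls_incl _ f).symm⟩

theorem cls_add {r : ℝ} {A B : C} (f g : Hom k r A B) : cls (f + g) = cls f + cls g :=
  (DirectLimit.add_def (G := fun r : ℝ => Hom k r A B)
    (f := fun _ _ h => incl (k := k) (A := A) (B := B) h) r f g).symm

/-- Composition in `C_∞`: `[f] ≫ [g] = [f ≫ g]`, see `compInf_cls`. -/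
noncomputable def compInf {A B D : C} (φ : HomInf k A B) (ψ : HomInf k B D) : HomInf k A D :=
  DirectLimit.lift₂ _ _ (fun _ f g => cls (comp f g))
    (fun _ _ h f g => by rw [← incl_comp, cls_incl]) φ ψ

theorem compInf_cls {r s : ℝ} {A B D : C} (f : Hom k r A B) (g : Hom k s B D) :
    compInf (cls f) (cls g) = cls (comp f g) := by
  rw [← cls_incl (le_max_left r s) f, ← cls_incl (le_max_right r s) g,
    ← cls_incl (add_le_add (le_max_left r s) (le_max_right r s)) (comp f g), incl_comp]
  exact DirectLimit.lift₂_def _ _ _ _ _ _ _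

/-- Two elements of the direct limit can be represented at the same level. -/
theorem exists_cls₂ {A B A' B' : C} (φ : HomInf k A B) (ψ : HomInf k A' B') :
    ∃ (r : ℝ) (_ : 0 ≤ r) (f : Hom k r A B) (g : Hom k r A' B'), φ = cls f ∧ ψ = cls g := by
  obtain ⟨r, hr, f, rfl⟩ := exists_cls φ
  obtain ⟨s, hs, g, rfl⟩ := exists_cls ψ
  exact ⟨max r s, le_max_of_le_left hr, incl (le_max_left _ _) f, incl (le_max_right _ _) g,
    (cls_incl _ f).symm, (cls_incl _ g).symm⟩

variable (k C)

/-- The limit category `C_∞`: the objects of `C`, with morphisms the direct limits. -/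
noncomputable instance : Category (LevelInf k C) where
  Hom A B := HomInf k A.as B.as
  id A := cls (ident A.as)
  comp φ ψ := compInf φ ψ
  id_comp {A B} φ := by
    obtain ⟨r, _, f, rfl⟩ := exists_cls φ
    rw [compInf_cls, ident_comp, cls_incl]
  comp_id φ := by
    obtain ⟨r, _, f, rfl⟩ := exists_cls φ
    rw [compInf_cls, comp_ident, cls_incl]
  assoc φ ψ χ := by
    obtain ⟨r, _, f, rfl⟩ := exists_cls φ
    obtain ⟨s, _, g, rfl⟩ := exists_cls ψ
    obtain ⟨t, _, h, rfl⟩ := exists_cls χ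
    rw [compInf_cls, compInf_cls, compInf_cls, compInf_cls, comp_assoc, cls_incl]

noncomputable instance : Preadditive (LevelInf k C) where
  homGroup A B := inferInstanceAs (AddCommGroup (HomInf k A.as B.as))
  add_comp A B D φ φ' ψ := by
    change HomInf k A.as B.as at φ φ'
    change HomInf k B.as D.as at ψ
    change compInf (φ + φ') ψ = compInf φ ψ + compInf φ' ψ
    obtain ⟨r, _, f, f', rfl, rfl⟩ := exists_cls₂ φ φ'
    obtain ⟨s, _, g, rfl⟩ := exists_cls ψ
    rw [← cls_add, compInf_cls, compInf_cls, compInf_cls, map_add, LinearMap.add_apply, cls_add]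
  comp_add A B D φ ψ ψ' := by
    change HomInf k A.as B.as at φ
    change HomInf k B.as D.as at ψ ψ'
    change compInf φ (ψ + ψ') = compInf φ ψ + compInf φ ψ'
    obtain ⟨r, _, g, g', rfl, rfl⟩ := exists_cls₂ ψ ψ'
    obtain ⟨s, _, f, rfl⟩ := exists_cls φ
    rw [← cls_add, compInf_cls, compInf_cls, compInf_cls, map_add, cls_add]

variable {k C}

/-- The class `[f] : A ⟶ B` in `C_∞` of a morphism `f` of shift `r`. -/
def toInf {r : ℝ} {A B : C} (f : Hom k r A B) : (⟨A⟩ : LevelInf k C) ⟶ ⟨B⟩ := cls f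

theorem toInf_incl {r s : ℝ} (h : r ≤ s) {A B : C} (f : Hom k r A B) :
    toInf (incl h f) = toInf f :=
  cls_incl h f

theorem toInf_comp {r s : ℝ} {A B D : C} (f : Hom k r A B) (g : Hom k s B D) :
    toInf (comp f g) = toInf f ≫ toInf g :=
  (compInf_cls f g).symm

theorem toInf_ident (A : C) : toInf (ident (k := k) A) = 𝟙 (⟨A⟩ : LevelInf k C) := rfl

variable (k C)

/-- The canonical functor `C₀ ⥤ C_∞`, the identity on objects. -/
noncomputable def limitFunctor : Level0 k C ⥤ LevelInf k C where
  obj A := ⟨A.as⟩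
  map f := toInf (ofZero f)
  map_id _ := rfl
  map_comp f g := (toInf_incl _ (comp (ofZero f) (ofZero g))).trans (toInf_comp _ _)

instance : (limitFunctor k C).Additive where
  map_add {_ _ f g} := cls_add (ofZero f) (ofZero g)

instance [HasZeroObject (Level0 k C)] : HasZeroObject (LevelInf k C) :=
  ⟨_, (limitFunctor k C).map_isZero (isZero_zero (Level0 k C))⟩

end Levels

/-! ## Shift functors -/

/-- A shift functor on a persistence category, presented by the objects `Σ^r A` together with
the isomorphisms `(η_{0,r})_A : A → Σ^r A` of shift `r`, with inverses
`(η_{r,0})_A : Σ^r A → A` of shift `-r`.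

By naturality of `η` these data determine the whole functor `Σ`: on morphisms
`Σ^r f = (η_{0,r})_B ∘ f ∘ (η_{r,0})_A`, and `η_{r,s} = η_{0,s} ∘ η_{r,0}`.  All functoriality,
naturality and monoidality relations then hold, the identifications `Σ^0 A = A` and
`Σ^s Σ^r A = Σ^{r+s} A` being the canonical isomorphisms of shift `0` given by `η`.  Thus strict
monoidal functors from the codiscrete category `(ℝ, +)` to the persistence endofunctors, with
`η_{x,y}` of shift `y - x`, are the special case in which these canonical isomorphisms are
identities. -/
class ShiftFunctor (k : Type w) [Field k] (C : Type u) [PersistenceCategory.{w, v, u} k C] where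
  obj : ℝ → C → C
  eta : ∀ (r : ℝ) (A : C), Hom k r A (obj r A)
  etaInv : ∀ (r : ℝ) (A : C), Hom k (-r) (obj r A) A
  eta_comp_etaInv : ∀ (r : ℝ) (A : C),
    incl (add_neg_cancel r).le (comp (eta r A) (etaInv r A)) = ident A
  etaInv_comp_eta : ∀ (r : ℝ) (A : C),
    incl (neg_add_cancel r).le (comp (etaInv r A) (eta r A)) = ident (obj r A)

section Shift

variable {k : Type w} [Field k] {C : Type u} [PersistenceCategory.{w, v, u} k C]
  [ShiftFunctor k C]

open ShiftFunctor (eta etaInv)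

/-- The object `Σ^r A`, in the `0`-level category. -/
def shObj (r : ℝ) (A : Level0 k C) : Level0 k C := ⟨ShiftFunctor.obj k r A.as⟩

/-- The morphism `Σ^r f : Σ^r A ⟶ Σ^r B` of `C₀`, for `f : A ⟶ B` in `C₀`:
the composition of `η_{r,0}`, `f` and `η_{0,r}`, which has shift `-r + (0 + r) = 0`. -/
def shMap (r : ℝ) {A B : Level0 k C} (f : A ⟶ B) : shObj r A ⟶ shObj r B :=
  toZero (incl (by simp : -r + (0 + r) ≤ 0)
    (comp (etaInv r A.as) (comp (ofZero f) (eta r B.as))))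

/-- The canonical identification `Σ^r Σ^{-r} A ⟶ A` in `C₀`. -/
def shCancel (r : ℝ) (A : Level0 k C) : shObj r (shObj (-r) A) ⟶ A :=
  toZero (incl (by simp : -r + -(-r) ≤ 0)
    (comp (etaInv r (ShiftFunctor.obj k (-r) A.as)) (etaInv (-r) A.as)))

/-- The morphism `η_r^A : Σ^r A ⟶ A` of `C₀`, for `r ≥ 0`: the image of `(η_{r,0})_A`, of shift
`-r`, under the persistence structure map from level `-r` to level `0`. -/
def etaZero (r : ℝ) (hr : 0 ≤ r) (A : Level0 k C) : shObj r A ⟶ A :=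
  toZero (incl (neg_nonpos.2 hr) (etaInv r A.as))

/-- `(η_{0,r})_A : A ⟶ Σ^r A` in `C_∞`. -/
def etaInf (r : ℝ) (A : Level0 k C) :
    (limitFunctor k C).obj A ⟶ (limitFunctor k C).obj (shObj r A) :=
  toInf (eta r A.as)

/-- `(η_{r,0})_A : Σ^r A ⟶ A` in `C_∞`. -/
def etaInvInf (r : ℝ) (A : Level0 k C) :
    (limitFunctor k C).obj (shObj r A) ⟶ (limitFunctor k C).obj A :=
  toInf (etaInv r A.as)

theorem etaInf_etaInvInf (r : ℝ) (A : Level0 k C) : etaInf r A ≫ etaInvInf r A = 𝟙 _ := by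
  refine (toInf_comp (eta r A.as) (etaInv r A.as)).symm.trans ?_
  rw [← toInf_incl (add_neg_cancel r).le, ShiftFunctor.eta_comp_etaInv]
  rfl

theorem etaInvInf_etaInf (r : ℝ) (A : Level0 k C) : etaInvInf r A ≫ etaInf r A = 𝟙 _ := by
  refine (toInf_comp (etaInv r A.as) (eta r A.as)).symm.trans ?_
  rw [← toInf_incl (neg_add_cancel r).le, ShiftFunctor.etaInv_comp_eta]
  rfl

instance (r : ℝ) (A : Level0 k C) : IsIso (etaInvInf r A) :=
  ⟨etaInf r A, etaInvInf_etaInf r A, etaInf_etaInvInf r A⟩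

theorem limitFunctor_map_etaZero (r : ℝ) (hr : 0 ≤ r) (A : Level0 k C) :
    (limitFunctor k C).map (etaZero r hr A) = etaInvInf r A :=
  toInf_incl _ _

/-- Every morphism of `C_∞` becomes one of `C₀` after shifting its source. -/
theorem exists_limitFunctor_map {A B : Level0 k C}
    (φ : (limitFunctor k C).obj A ⟶ (limitFunctor k C).obj B) :
    ∃ (r : ℝ) (_ : 0 ≤ r) (f : shObj r A ⟶ B),
      φ = etaInf r A ≫ (limitFunctor k C).map f := by
  obtain ⟨r, hr, f, rfl⟩ := exists_cls φ
  refine ⟨r, hr, toZero (incl (neg_add_cancel r).le (comp (etaInv r A.as) f)), ?_⟩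
  have h : (limitFunctor k C).map (X := shObj r A) (Y := B)
      (toZero (incl (neg_add_cancel r).le (comp (etaInv r A.as) f))) =
        etaInvInf r A ≫ toInf f :=
    (toInf_incl _ _).trans (toInf_comp _ _)
  rw [h]
  exact ((Category.assoc _ _ _).symm.trans
    ((congrArg (· ≫ toInf (A := A.as) (B := B.as) f) (etaInf_etaInvInf r A)).trans
      (Category.id_comp _))).symm

end Shift

/-! ## Triangulated persistence categories -/

/-- The translation functors `T^n` of `C₀`, together with their extension to persistence
endofunctors of `C`. -/
class PersistenceTranslation (k : Type w) [Field k] (C : Type u)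
    [PersistenceCategory.{w, v, u} k C] [HasShift (Level0 k C) ℤ] where
  tr : ∀ (n : ℤ) {r : ℝ} {A B : C},
    Hom k r A B →+ Hom k r ((⟨A⟩ : Level0 k C)⟦n⟧).as ((⟨B⟩ : Level0 k C)⟦n⟧).as
  tr_incl : ∀ (n : ℤ) {r s : ℝ} (h : r ≤ s) {A B : C} (f : Hom k r A B),
    tr n (incl h f) = incl h (tr n f)
  tr_comp : ∀ (n : ℤ) {r s : ℝ} {A B D : C} (f : Hom k r A B) (g : Hom k s B D),
    tr n (comp f g) = comp (tr n f) (tr n g)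
  tr_zero : ∀ (n : ℤ) {A B : Level0 k C} (f : A ⟶ B), tr n (ofZero f) = ofZero (f⟦n⟧')

section Translation

variable {k : Type w} [Field k] {C : Type u} [PersistenceCategory.{w, v, u} k C]
  [ShiftFunctor k C] [HasShift (Level0 k C) ℤ] [PersistenceTranslation k C]

open ShiftFunctor (eta etaInv)
open PersistenceTranslation

/-- The canonical identification `Σ^r (T A) ⟶ T (Σ^r A)` in `C₀`: the composition of
`(η_{r,0})_{TA}` and `T((η_{0,r})_A)`.  It is the identity if `Σ^r` and `T` commute strictly and
`T((η_{0,r})_A) = (η_{0,r})_{TA}`. -/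
def shTr (r : ℝ) (A : Level0 k C) : shObj r (A⟦(1 : ℤ)⟧) ⟶ (shObj r A)⟦(1 : ℤ)⟧ :=
  toZero (incl (neg_add_cancel r).le
    (comp (etaInv r (A⟦(1 : ℤ)⟧).as) (tr (k := k) 1 (eta r A.as))))

/-- The triangle `Σ^r A ⟶ Σ^r B ⟶ Σ^r D ⟶ T Σ^r A` in `C₀` obtained by applying `Σ^r` to a
triangle `A ⟶ B ⟶ D ⟶ T A`. -/
def shTriangle (r : ℝ) (Δ : Triangle (Level0 k C)) : Triangle (Level0 k C) :=
  Triangle.mk (shMap r Δ.mor₁) (shMap r Δ.mor₂) (shMap r Δ.mor₃ ≫ shTr r Δ.obj₁)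

/-- `K` is `r`-acyclic: the identity of `K` becomes zero in `Hom r K K`. -/
def IsAcyclic (r : ℝ) (hr : 0 ≤ r) (K : Level0 k C) : Prop :=
  incl hr (ident (k := k) K.as) = 0

end Translation

/-- A triangulated persistence category: a persistence category with a shift functor, whose
`0`-level is triangulated, such that
* `T` extends to a persistence functor and each `Σ^r` is a triangulated endofunctor of `C₀`;
* for every `r ≥ 0`, the morphism `η_r^A : Σ^r A ⟶ A` has an `r`-acyclic cone in `C₀`.
Compatibility of the persistence structure and of `η` with direct sums is automatic, since
composition is bilinear and commutes with the structure maps. -/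
class TriangulatedPersistenceCategory (k : Type w) [Field k] (C : Type u)
    [PersistenceCategory.{w, v, u} k C] [ShiftFunctor k C]
    [HasZeroObject (Level0 k C)] [HasShift (Level0 k C) ℤ]
    [∀ n : ℤ, (shiftFunctor (Level0 k C) n).Additive] [Pretriangulated (Level0 k C)]
    [PersistenceTranslation k C] : Prop where
  isTriangulated : IsTriangulated (Level0 k C)
  shift_distinguished : ∀ (r : ℝ) (Δ : Triangle (Level0 k C)),
    Δ ∈ distTriang (Level0 k C) → shTriangle r Δ ∈ distTriang (Level0 k C)
  exists_acyclic_cone : ∀ (r : ℝ) (hr : 0 ≤ r) (A : Level0 k C),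
    ∃ (K : Level0 k C) (v : A ⟶ K) (w : K ⟶ (shObj r A)⟦(1 : ℤ)⟧),
      Triangle.mk (etaZero r hr A) v w ∈ distTriang (Level0 k C) ∧ IsAcyclic r hr K

/-! ## The translation functor on the limit category -/

section LimitShift

variable (k : Type w) [Field k] (C : Type u) [PersistenceCategory.{w, v, u} k C]
  [ShiftFunctor k C] [HasShift (Level0 k C) ℤ] [PersistenceTranslation k C]

open PersistenceTranslation

/-- The endofunctor of `C_∞` induced by `T^n`, given by `[f] ↦ [T^n f]`. -/
noncomputable def trInf (n : ℤ) : LevelInf k C ⥤ LevelInf k C where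
  obj A := (limitFunctor k C).obj ((⟨A.as⟩ : Level0 k C)⟦n⟧)
  map φ := DirectLimit.lift _ (fun _ f => toInf (tr (k := k) n f))
    (fun _ _ h f => by rw [tr_incl, toInf_incl]) φ
  map_id A := by
    change toInf (tr (k := k) n (ofZero (𝟙 (⟨A.as⟩ : Level0 k C)))) = _
    rw [tr_zero, CategoryTheory.Functor.map_id]
    rfl
  map_comp φ ψ := by
    obtain ⟨r, -, f, rfl⟩ := exists_cls φ
    obtain ⟨s, -, g, rfl⟩ := exists_cls ψ
    change DirectLimit.lift _ _ _ (compInf (cls f) (cls g)) = _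
    rw [compInf_cls]
    change toInf (tr (k := k) n (comp f g)) = toInf (tr n f) ≫ toInf (tr n g)
    rw [tr_comp, toInf_comp]

/-- `T^n` on `C_∞` is compatible with `T^n` on `C₀`. -/
noncomputable def limitFunctorCompTrInf (n : ℤ) :
    limitFunctor k C ⋙ trInf k C n ≅ shiftFunctor (Level0 k C) n ⋙ limitFunctor k C :=
  NatIso.ofComponents (fun A => Iso.refl _) (fun {A B} f => by
    have h : (trInf k C n).map ((limitFunctor k C).map f) = (limitFunctor k C).map (f⟦n⟧') := by
      change toInf (tr (k := k) n (ofZero f)) = _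
      rw [tr_zero]
      rfl
    exact ((Category.comp_id _).trans h).trans (Category.id_comp _).symm)

/-- Naturality with respect to `e` and `f` implies naturality with respect to `e⁻¹ ≫ f`. -/
theorem naturality_of_epi {D : Type*} [Category* D] {E : Type*} [Category* E] (F G : D ⥤ E)
    {X Y Z : D} (e : Y ⟶ X) (e' : X ⟶ Y) (f : Y ⟶ Z) (h : e ≫ e' = 𝟙 _) (h' : e' ≫ e = 𝟙 _)
    (tX : F.obj X ⟶ G.obj X) (tY : F.obj Y ⟶ G.obj Y) (tZ : F.obj Z ⟶ G.obj Z)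
    (he : F.map e ≫ tX = tY ≫ G.map e) (hf : F.map f ≫ tZ = tY ≫ G.map f) :
    F.map (e' ≫ f) ≫ tZ = tX ≫ G.map (e' ≫ f) := by
  have h1 : F.map e' ≫ tY = tX ≫ G.map e' := by
    calc F.map e' ≫ tY = F.map e' ≫ tY ≫ G.map (e ≫ e') := by rw [h]; simp
      _ = F.map e' ≫ (F.map e ≫ tX) ≫ G.map e' := by rw [he]; simp
      _ = F.map (e' ≫ e) ≫ tX ≫ G.map e' := by simp
      _ = tX ≫ G.map e' := by rw [h']; simp
  rw [F.map_comp, G.map_comp, Category.assoc, hf, ← Category.assoc, h1, Category.assoc]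

instance : ((Functor.whiskeringLeft (Level0 k C) (LevelInf k C) (LevelInf k C)).obj
    (limitFunctor k C)).Faithful where
  map_injective {F G} τ τ' h := by
    ext A
    exact NatTrans.congr_app h ⟨A.as⟩

instance : ((Functor.whiskeringLeft (Level0 k C) (LevelInf k C) (LevelInf k C)).obj
    (limitFunctor k C)).Full where
  map_surjective {F G} τ := by
    refine ⟨{ app := fun A => τ.app ⟨A.as⟩, naturality := ?_ }, rfl⟩
    intro A B φ
    obtain ⟨r, hr, f, rfl⟩ := exists_limitFunctor_map (A := ⟨A.as⟩) (B := ⟨B.as⟩) φ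
    exact naturality_of_epi F G (etaInvInf r ⟨A.as⟩) (etaInf r ⟨A.as⟩)
      ((limitFunctor k C).map f) (etaInvInf_etaInf r ⟨A.as⟩) (etaInf_etaInvInf r ⟨A.as⟩) _ _ _
      ((limitFunctor_map_etaZero r hr (⟨A.as⟩ : Level0 k C)) ▸
        τ.naturality (etaZero r hr (⟨A.as⟩ : Level0 k C))) (τ.naturality f)

/-- The shift by `ℤ` on `C_∞`, with `shiftFunctor n = trInf n`. -/
noncomputable instance : HasShift (LevelInf k C) ℤ :=
  HasShift.induced (limitFunctor k C) ℤ (trInf k C) (limitFunctorCompTrInf k C)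

noncomputable instance : (limitFunctor k C).CommShift ℤ :=
  Functor.CommShift.ofInduced (limitFunctor k C) ℤ (trInf k C) (limitFunctorCompTrInf k C)

instance (n : ℤ) : (shiftFunctor (LevelInf k C) n).Additive where
  map_add {A B φ ψ} := by
    change HomInf k A.as B.as at φ ψ
    obtain ⟨r, -, f, g, rfl, rfl⟩ := exists_cls₂ φ ψ
    change (trInf k C n).map (cls f + cls g) = cls (tr n f) + cls (tr n g)
    rw [← cls_add, ← cls_add, ← map_add]
    rfl

end LimitShift

/-! ## Triangular weights -/

section TriangularWeights

variable {D : Type*} [Category* D] [HasZeroObject D] [HasShift D ℤ] [Preadditive D]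
  [∀ n : ℤ, (shiftFunctor D n).Additive]

/-- The commutativity of the diagram
```
  A  --->  0  ---> TA  ---> TA
  |        |       |        |
  B  -p->  Y  -g-> F  -h->  TB
  |        |       |        |
  X  -d->  Y  -e-> E  -f->  TX
  |        |       |        |
  TA --->  0 ---> TTA ---> TTA
```
with columns `A -a-> B -b-> X -c-> TA`, `0 ⟶ Y ⟶ Y ⟶ 0`, `TA -x-> F -y-> E -z-> TTA` and
`TA -Ta-> TB -Tb-> TX -Tc-> TTA` (and identities in the outer rows and the second column), except
for the bottom right square, which anti-commutes.  The squares that commute for every choice of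
the morphisms are left out. -/
structure OctahedralDiagram {A B X Y E F : D}
    (a : A ⟶ B) (b : B ⟶ X) (c : X ⟶ A⟦(1 : ℤ)⟧)
    (d : X ⟶ Y) (e : Y ⟶ E) (f : E ⟶ X⟦(1 : ℤ)⟧)
    (p : B ⟶ Y) (g : Y ⟶ F) (h : F ⟶ B⟦(1 : ℤ)⟧)
    (x : A⟦(1 : ℤ)⟧ ⟶ F) (y : F ⟶ E) (z : E ⟶ A⟦(1 : ℤ)⟧⟦(1 : ℤ)⟧) : Prop where
  sq_AY : a ≫ p = 0
  sq_TATB : x ≫ h = a⟦(1 : ℤ)⟧'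
  sq_BY : b ≫ d = p
  sq_YE : g ≫ y = e
  sq_FTX : y ≫ f = h ≫ b⟦(1 : ℤ)⟧'
  sq_YTTA : e ≫ z = 0
  sq_ETTA : f ≫ c⟦(1 : ℤ)⟧' = -z

/-- `Δ'` is obtained from `Δ` by finitely many positive and negative rotations. -/
inductive IsRotationOf (Δ : Triangle D) : Triangle D → Prop
  | refl : IsRotationOf Δ Δ
  | rotate {Δ' : Triangle D} : IsRotationOf Δ Δ' → IsRotationOf Δ Δ'.rotate
  | invRotate {Δ' : Triangle D} : IsRotationOf Δ Δ' → IsRotationOf Δ Δ'.invRotate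

variable [Pretriangulated D]

/-- The exact triangles `Δ₁ = (a, b, c)` and `Δ₂ = (d, e, f)` can be completed to an octahedral
diagram with exact triangles `Δ₃ = (p, g, h)` and `Δ₄ = (x, y, z)` of total weight at most
`bound`. -/
def HasWeightedOctahedron (w : Triangle D → ℝ≥0∞) {A B X Y E : D}
    (a : A ⟶ B) (b : B ⟶ X) (c : X ⟶ A⟦(1 : ℤ)⟧)
    (d : X ⟶ Y) (e : Y ⟶ E) (f : E ⟶ X⟦(1 : ℤ)⟧) (bound : ℝ≥0∞) : Prop :=
  ∃ (F : D) (p : B ⟶ Y) (g : Y ⟶ F) (h : F ⟶ B⟦(1 : ℤ)⟧)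
    (x : A⟦(1 : ℤ)⟧ ⟶ F) (y : F ⟶ E) (z : E ⟶ A⟦(1 : ℤ)⟧⟦(1 : ℤ)⟧),
    Triangle.mk p g h ∈ distTriang D ∧ Triangle.mk x y z ∈ distTriang D ∧
      OctahedralDiagram a b c d e f p g h x y z ∧
      w (Triangle.mk p g h) + w (Triangle.mk x y z) ≤ bound

/-- `w` (restricted to exact triangles) is a triangular weight on `D` with normalization constant
`w₀`; here `Z` is the zero object used in the normalization axiom (a weight need not be invariant
under isomorphisms, so the zero object has to be specified).  The inequality in the weighted
octahedral axiom is required up to an arbitrary `ε > 0`. -/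
structure IsTriangularWeight (w : Triangle D → ℝ≥0∞) (w₀ : ℝ≥0) (Z : D) : Prop where
  isZero : IsZero Z
  /-- Exact triangles have finite weight. -/
  ne_top : ∀ Δ ∈ distTriang D, w Δ ≠ ⊤
  /-- The weighted octahedral axiom. -/
  octahedral : ∀ {A B X Y E : D} (a : A ⟶ B) (b : B ⟶ X) (c : X ⟶ A⟦(1 : ℤ)⟧)
    (d : X ⟶ Y) (e : Y ⟶ E) (f : E ⟶ X⟦(1 : ℤ)⟧),
    Triangle.mk a b c ∈ distTriang D → Triangle.mk d e f ∈ distTriang D →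
    ∀ ε : ℝ≥0, 0 < ε → HasWeightedOctahedron w a b c d e f
      (w (Triangle.mk a b c) + w (Triangle.mk d e f) + ε)
  /-- Normalization. -/
  le_weight : ∀ Δ ∈ distTriang D, (w₀ : ℝ≥0∞) ≤ w Δ
  weight_rotation : ∀ (X : D) (Δ : Triangle D),
    IsRotationOf (Triangle.mk (0 : Z ⟶ X) (𝟙 X) (0 : X ⟶ Z⟦(1 : ℤ)⟧)) Δ → w Δ = w₀
  /-- If `B = 0` then `Δ₃` can be taken to be `0 ⟶ Y ⟶ Y ⟶ 0`. -/
  octahedral_zero : ∀ {A X Y E : D} (a : A ⟶ Z) (b : Z ⟶ X) (c : X ⟶ A⟦(1 : ℤ)⟧)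
    (d : X ⟶ Y) (e : Y ⟶ E) (f : E ⟶ X⟦(1 : ℤ)⟧),
    Triangle.mk a b c ∈ distTriang D → Triangle.mk d e f ∈ distTriang D →
    ∃ (x : A⟦(1 : ℤ)⟧ ⟶ Y) (y : Y ⟶ E) (z : E ⟶ A⟦(1 : ℤ)⟧⟦(1 : ℤ)⟧),
      Triangle.mk x y z ∈ distTriang D ∧
      OctahedralDiagram a b c d e f (0 : Z ⟶ Y) (𝟙 Y) (0 : Y ⟶ Z⟦(1 : ℤ)⟧) x y z ∧
      w (Triangle.mk (0 : Z ⟶ Y) (𝟙 Y) (0 : Y ⟶ Z⟦(1 : ℤ)⟧)) + w (Triangle.mk x y z) ≤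
        w (Triangle.mk a b c) + w (Triangle.mk d e f)

/-- Subadditivity of a weight, relative to a choice `bp` of direct sums: for every exact triangle
`Δ : A ⟶ B ⟶ E ⟶ TA` and every object `X`, the triangles
`X ⊕ Δ : A ⟶ X ⊕ B ⟶ X ⊕ E ⟶ TA` and `Δ ⊕ X : A ⟶ B ⊕ X ⟶ E ⊕ X ⟶ TA` are exact, of weight at
most that of `Δ`. -/
structure IsSubadditive (w : Triangle D → ℝ≥0∞) (bp : ∀ X Y : D, BinaryBiproductData X Y) :
    Prop where
  left : ∀ {A B E : D} (X : D) (a : A ⟶ B) (b : B ⟶ E) (c : E ⟶ A⟦(1 : ℤ)⟧),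
    Triangle.mk a b c ∈ distTriang D →
    Triangle.mk (a ≫ (bp X B).bicone.inr)
        ((bp X B).bicone.fst ≫ (bp X E).bicone.inl +
          (bp X B).bicone.snd ≫ b ≫ (bp X E).bicone.inr)
        ((bp X E).bicone.snd ≫ c) ∈ distTriang D ∧
      w (Triangle.mk (a ≫ (bp X B).bicone.inr)
        ((bp X B).bicone.fst ≫ (bp X E).bicone.inl +
          (bp X B).bicone.snd ≫ b ≫ (bp X E).bicone.inr)
        ((bp X E).bicone.snd ≫ c)) ≤ w (Triangle.mk a b c)
  right : ∀ {A B E : D} (X : D) (a : A ⟶ B) (b : B ⟶ E) (c : E ⟶ A⟦(1 : ℤ)⟧),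
    Triangle.mk a b c ∈ distTriang D →
    Triangle.mk (a ≫ (bp B X).bicone.inl)
        ((bp B X).bicone.fst ≫ b ≫ (bp E X).bicone.inl +
          (bp B X).bicone.snd ≫ (bp E X).bicone.inr)
        ((bp E X).bicone.fst ≫ c) ∈ distTriang D ∧
      w (Triangle.mk (a ≫ (bp B X).bicone.inl)
        ((bp B X).bicone.fst ≫ b ≫ (bp E X).bicone.inl +
          (bp B X).bicone.snd ≫ (bp E X).bicone.inr)
        ((bp E X).bicone.fst ≫ c)) ≤ w (Triangle.mk a b c)

end TriangularWeights

/-! ## Weighted exact triangles -/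

section StrictExact

variable {k : Type w} [Field k] {C : Type u} [PersistenceCategory.{w, v, u} k C]
  [ShiftFunctor k C] [HasZeroObject (Level0 k C)] [HasShift (Level0 k C) ℤ]
  [∀ n : ℤ, (shiftFunctor (Level0 k C) n).Additive] [Pretriangulated (Level0 k C)]

/-- `f` is an `r`-isomorphism: it has an `r`-acyclic cone in `C₀`. -/
def IsRIso (r : ℝ) (hr : 0 ≤ r) {A B : Level0 k C} (f : A ⟶ B) : Prop :=
  ∃ (K : Level0 k C) (v : B ⟶ K) (w : K ⟶ A⟦(1 : ℤ)⟧),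
    Triangle.mk f v w ∈ distTriang (Level0 k C) ∧ IsAcyclic r hr K

/-- `A -u-> B -v-> X -w-> Σ^{-r} T A` is a strict exact triangle of weight `r`. -/
def IsStrictExact (r : ℝ) (hr : 0 ≤ r) {A B X : Level0 k C} (u : A ⟶ B) (v : B ⟶ X)
    (w : X ⟶ shObj (-r) (A⟦(1 : ℤ)⟧)) : Prop :=
  ∃ (X' : Level0 k C) (v' : B ⟶ X') (w' : X' ⟶ A⟦(1 : ℤ)⟧) (φ : X' ⟶ X) (ψ : shObj r X ⟶ X'),
    Triangle.mk u v' w' ∈ distTriang (Level0 k C) ∧ IsRIso r hr φ ∧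
      ψ ≫ φ = etaZero r hr X ∧ v' ≫ φ = v ∧ ψ ≫ w' = shMap r w ≫ shCancel r (A⟦(1 : ℤ)⟧)

variable (k C) in
/-- The acyclic objects: those which are `r`-acyclic for some `r ≥ 0`. -/
def acyclics : ObjectProperty (Level0 k C) :=
  fun K => ∃ (r : ℝ) (hr : 0 ≤ r), IsAcyclic r hr K

variable [PersistenceTranslation k C]

/-- The weights of the strict exact triangles
`A -u'-> Σ^{-q} B -v'-> Σ^{-s} X -w'-> Σ^{-r} T A` with `0 ≤ q ≤ s ≤ r` which represent the
triangle `A -u-> B -v-> X -w-> T A` of `C_∞`. -/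
def unstableWeights {A B X : Level0 k C}
    (u : (limitFunctor k C).obj A ⟶ (limitFunctor k C).obj B)
    (v : (limitFunctor k C).obj B ⟶ (limitFunctor k C).obj X)
    (w : (limitFunctor k C).obj X ⟶ ((limitFunctor k C).obj A)⟦(1 : ℤ)⟧) : Set ℝ :=
  {r | ∃ (hr : 0 ≤ r) (q s : ℝ) (_ : 0 ≤ q) (_ : q ≤ s) (_ : s ≤ r)
    (u' : A ⟶ shObj (-q) B) (v' : shObj (-q) B ⟶ shObj (-s) X)
    (w' : shObj (-s) X ⟶ shObj (-r) (A⟦(1 : ℤ)⟧)),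
    IsStrictExact r hr u' v' w' ∧
    (limitFunctor k C).map u' ≫ etaInvInf (-q) B = u ∧
    etaInf (-q) B ≫ (limitFunctor k C).map v' ≫ etaInvInf (-s) X = v ∧
    etaInf (-s) X ≫ (limitFunctor k C).map w' ≫ etaInvInf (-r) (A⟦(1 : ℤ)⟧) ≫
      ((limitFunctor k C).commShiftIso (1 : ℤ)).hom.app A = w}

/-- The object of `C₀` underlying an object of `C_∞`. -/
def LevelInf.toLevel0 (A : LevelInf k C) : Level0 k C := ⟨A.as⟩

/-- The weights of the strict exact triangles which represent the triangle `Σ^{t,0,0,t} Δ`, that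
is `Σ^t A ⟶ B ⟶ X ⟶ T Σ^t A`, where `Δ : A ⟶ B ⟶ X ⟶ T A` is a triangle of `C_∞`. -/
def shiftedWeights (t : ℝ) (Δ : Triangle (LevelInf k C)) : Set ℝ :=
  unstableWeights (A := shObj t Δ.obj₁.toLevel0) (B := Δ.obj₂.toLevel0) (X := Δ.obj₃.toLevel0)
    (etaInvInf t Δ.obj₁.toLevel0 ≫ Δ.mor₁) Δ.mor₂
    (Δ.mor₃ ≫ (etaInf t Δ.obj₁.toLevel0)⟦(1 : ℤ)⟧')

/-- The unstable weight of `Σ^{t,0,0,t} Δ`. -/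
noncomputable def shiftedUnstableWeight (t : ℝ) (Δ : Triangle (LevelInf k C)) : ℝ≥0∞ :=
  ⨅ r ∈ shiftedWeights t Δ, ENNReal.ofReal r

/-- The persistence weight `w̄(Δ)`: the infimum over `t ≥ 0` of the unstable weights of
`Σ^{t,0,0,t} Δ`. -/
noncomputable def persistenceWeight (Δ : Triangle (LevelInf k C)) : ℝ≥0∞ :=
  ⨅ (t : ℝ) (_ : 0 ≤ t), shiftedUnstableWeight t Δ

/-- The infimum defining `w̄(Δ)` is attained by some strict exact triangle. -/
def WeightIsAttained (Δ : Triangle (LevelInf k C)) : Prop :=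
  ∃ t : ℝ, 0 ≤ t ∧ ∃ r ∈ shiftedWeights t Δ, ENNReal.ofReal r = persistenceWeight Δ

/-- A choice of direct sums in `C₀` gives direct sums in `C_∞`. -/
noncomputable def limitBiproducts
    (bp : ∀ A B : Level0 k C, BinaryBiproductData A B) (A B : LevelInf k C) :
    BinaryBiproductData A B where
  bicone := (limitFunctor k C).mapBinaryBicone (bp A.toLevel0 B.toLevel0).bicone
  isBilimit :=
    haveI := preservesBinaryBiproduct_of_preservesBiproduct (limitFunctor k C)
      A.toLevel0 B.toLevel0
    isBinaryBilimitOfPreserves (limitFunctor k C) (bp A.toLevel0 B.toLevel0).isBilimit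

end StrictExact

/-! ## Homogeneous isomorphisms of the limit category -/

section ShiftIso

variable {k : Type w} [Field k] {C : Type u} [PersistenceCategory.{w, v, u} k C]

/-! Verdier quotient. Every η_{r,0} is invertible in C_∞. Every morphism of C_∞ is a morphism of C₀
preceded by the inverse of some η_r (`exists_limitFunctor_map`), and two morphisms of C₀ agree in
C_∞ iff some η_r equalizes them (`limitFunctor_map_eq_iff`). The maps η_r have acyclic cones, and
conversely each r-isomorphism is inverted (`IsRIso.isIso_map`), because vanishing at level r means
being killed by η_r (`etaZero_comp_eq_zero_iff`), so that exact sequences produce one-sided inverses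
up to η_r. Hence the functor induced on the localization is an equivalence.

Weights. A strict exact triangle is recast as a model (`HasModel`): an exact triangle of C₀ compared
with the given triangle of C_∞ by homogeneous isomorphisms at the first two vertices and a
homogeneous r-isomorphism at the third. Since Σ^s is triangulated, only the differences of the three
shifts matter. As t ≥ 0 is free in the infimum, the shift at the second vertex can be normalized to
0, which leaves the conditions of `HasWeight`.

Octahedra. The model of Δ₁ is shifted until its third shift equals the first shift of the model of
Δ₂. The two models of the common vertex then differ by a homogeneous r-isomorphism of shift 0, that
is, by an r-isomorphism φ of C₀. Completing the composite through φ in C₀ gives Δ₃ of weight 0. Two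
octahedra in C₀ give Δ₄, whose third vertex is compared by an r-isomorphism followed by an
r'-isomorphism; levels of acyclicity add under extensions (`IsAcyclic.ext`), so r + r' is a weight
of Δ₄.

If B = 0, then Δ₄ is determined by Δ₁ and Δ₂, so the infimum can be taken without ε. For
subadditivity, 0 → X → X → 0 is added to a model; this works because the identity of X is an
r-isomorphism of every shift in [-r, 0] (`isShiftRIso_id`). -/

theorem ofZero_comp {A B D : Level0 k C} (f : A ⟶ B) (g : B ⟶ D) :
    ofZero (f ≫ g) = incl (add_zero (0 : ℝ)).le (comp (ofZero f) (ofZero g)) := rfl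

theorem ofZero_toZero {A B : C} (f : Hom k 0 A B) : ofZero (toZero f) = f := rfl

theorem level0_hom_ext {A B : Level0 k C} {f g : A ⟶ B} (h : ofZero f = ofZero g) : f = g := h

theorem exists_toInf {A B : LevelInf k C} (φ : A ⟶ B) :
    ∃ (r : ℝ) (_ : 0 ≤ r) (f : Hom k r A.as B.as), φ = toInf f :=
  exists_cls φ

theorem toInf_eq_toInf_iff {r : ℝ} {A B : C} (f g : Hom k r A B) :
    toInf f = toInf g ↔ ∃ (s : ℝ) (h : r ≤ s), incl h f = incl h g := by
  constructor
  · intro h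
    obtain ⟨s, h₁, h₂, h₃⟩ := Quotient.exact h
    exact ⟨s, h₁, h₃⟩
  · rintro ⟨s, h, e⟩
    rw [← toInf_incl h, e, toInf_incl]

/-- `h` and `h'` are mutually inverse homogeneous morphisms. -/
structure IsInversePair {x : ℝ} {A B : C} (h : Hom k (-x) A B) (h' : Hom k x B A) : Prop where
  hom_inv : incl (neg_add_cancel x).le (comp h h') = ident A
  inv_hom : incl (add_neg_cancel x).le (comp h' h) = ident B

namespace IsInversePair

variable {x : ℝ} {A B : C} {h : Hom k (-x) A B} {h' : Hom k x B A}

theorem comp_eq (H : IsInversePair h h') :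
    comp h h' = incl (neg_add_cancel x).ge (ident A) := by
  rw [← H.hom_inv, incl_incl, incl_refl]

theorem comp_eq' (H : IsInversePair h h') :
    comp h' h = incl (add_neg_cancel x).ge (ident B) := by
  rw [← H.inv_hom, incl_incl, incl_refl]

/-- Cancels an adjacent inverse pair inside a longer composite, once composites are bracketed to the
right. -/
theorem comp_assoc (H : IsInversePair h h') {D : C} {s : ℝ} (f : Hom k s A D) :
    comp h (comp h' f) = incl (by linarith) f := by
  have := PersistenceCategory.comp_assoc h h' f
  rw [H.comp_eq, comp_incl_left, ident_comp, incl_incl] at this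
  have h2 := congrArg (incl (k := k) (show (-x + x) + s ≤ -x + (x + s) by linarith)) this
  rw [incl_incl, incl_incl, incl_refl] at h2
  exact h2.symm

theorem comp_assoc' (H : IsInversePair h h') {D : C} {s : ℝ} (f : Hom k s B D) :
    comp h' (comp h f) = incl (by linarith) f := by
  have := PersistenceCategory.comp_assoc h' h f
  rw [H.comp_eq', comp_incl_left, ident_comp, incl_incl] at this
  have h2 := congrArg (incl (k := k) (show (x + -x) + s ≤ x + (-x + s) by linarith)) this
  rw [incl_incl, incl_incl, incl_refl] at h2
  exact h2.symm

end IsInversePair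

theorem isInversePair_eta [ShiftFunctor k C] (x : ℝ) (A : C) :
    IsInversePair (ShiftFunctor.etaInv x A) (ShiftFunctor.eta (k := k) x A) :=
  ⟨ShiftFunctor.etaInv_comp_eta x A, ShiftFunctor.eta_comp_etaInv x A⟩

/-- `e` is the class of an invertible morphism of shift `-x`; that is, it is
`etaInvInf x` up to an isomorphism of `C₀`. -/
def IsShiftIso (x : ℝ) {A B : LevelInf k C} (e : A ⟶ B) : Prop :=
  ∃ (h : Hom k (-x) A.as B.as) (h' : Hom k x B.as A.as), IsInversePair h h' ∧ e = toInf h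

theorem IsInversePair.toInf_comp {x : ℝ} {A B : C} {h : Hom k (-x) A B} {h' : Hom k x B A}
    (H : IsInversePair h h') : toInf h ≫ toInf h' = 𝟙 (⟨A⟩ : LevelInf k C) := by
  rw [← _root_.toInf_comp, H.comp_eq, toInf_incl, toInf_ident]

theorem IsInversePair.toInf_comp' {x : ℝ} {A B : C} {h : Hom k (-x) A B} {h' : Hom k x B A}
    (H : IsInversePair h h') : toInf h' ≫ toInf h = 𝟙 (⟨B⟩ : LevelInf k C) := by
  rw [← _root_.toInf_comp, H.comp_eq', toInf_incl, toInf_ident]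

namespace IsShiftIso

theorem isIso {x : ℝ} {A B : LevelInf k C} {e : A ⟶ B} (he : IsShiftIso x e) : IsIso e := by
  obtain ⟨h, h', H, rfl⟩ := he
  exact ⟨toInf h', H.toInf_comp, H.toInf_comp'⟩

theorem inv {x : ℝ} {A B : LevelInf k C} {e : A ⟶ B} [IsIso e] (he : IsShiftIso x e) :
    IsShiftIso (-x) (CategoryTheory.inv e) := by
  obtain ⟨h, h', H, rfl⟩ := he
  -- The levels x and - -x are equal but not syntactically so; `h'` is moved by the structure map
  -- between them.
  have e1 : x = - -x := by simp
  refine ⟨incl e1.le h', h, ⟨?_, ?_⟩, ?_⟩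
  · rw [comp_incl_left, H.comp_eq', incl_incl, incl_incl, incl_refl]
  · rw [comp_incl_right, H.comp_eq, incl_incl, incl_incl, incl_refl]
  · rw [toInf_incl]
    exact IsIso.inv_eq_of_hom_inv_id H.toInf_comp

theorem comp {x y : ℝ} {A B D : LevelInf k C} {e : A ⟶ B} {f : B ⟶ D} (he : IsShiftIso x e)
    (hf : IsShiftIso y f) : IsShiftIso (x + y) (e ≫ f) := by
  obtain ⟨h, h', H, rfl⟩ := he
  obtain ⟨g, g', G, rfl⟩ := hf
  refine ⟨incl (by linarith) (PersistenceCategory.comp h g),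
    incl (by linarith) (PersistenceCategory.comp g' h'), ⟨?_, ?_⟩, ?_⟩
  · simp only [comp_incl_left, comp_incl_right, comp_assoc, incl_incl, G.comp_assoc, H.comp_eq]
    exact incl_refl _
  · simp only [comp_incl_left, comp_incl_right, comp_assoc, incl_incl, H.comp_assoc', G.comp_eq']
    exact incl_refl _
  · rw [toInf_incl, toInf_comp]

theorem congr_shift {x y : ℝ} {A B : LevelInf k C} {e : A ⟶ B} (he : IsShiftIso x e)
    (h : x = y) : IsShiftIso y e := h ▸ he

theorem map_of_isIso {A B : Level0 k C} (f : A ⟶ B) [IsIso f] :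
    IsShiftIso 0 ((limitFunctor k C).map f) := by
  have e0 : (0 : ℝ) = -0 := by simp
  have H : IsInversePair (incl e0.le (ofZero f)) (ofZero (CategoryTheory.inv f)) := by
    refine ⟨?_, ?_⟩
    · rw [comp_incl_left, incl_incl]
      exact congrArg ofZero (IsIso.hom_inv_id f)
    · rw [comp_incl_right, incl_incl]
      exact congrArg ofZero (IsIso.inv_hom_id f)
  exact ⟨_, _, H, (toInf_incl _ _).symm⟩

theorem id (A : LevelInf k C) : IsShiftIso 0 (𝟙 A) := by
  have := map_of_isIso (𝟙 A.toLevel0)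
  rwa [CategoryTheory.Functor.map_id] at this

/-- A homogeneous isomorphism of shift `0` comes from `C₀`. -/
theorem exists_iso {A B : Level0 k C} {e : (limitFunctor k C).obj A ⟶ (limitFunctor k C).obj B}
    (he : IsShiftIso 0 e) : ∃ i : A ≅ B, e = (limitFunctor k C).map i.hom := by
  obtain ⟨h, h', H, rfl⟩ := he
  change Hom k (-0) A.as B.as at h
  change Hom k 0 B.as A.as at h'
  refine ⟨⟨toZero (incl (by simp) h), toZero h', ?_, ?_⟩, ?_⟩
  · apply level0_hom_ext
    rw [ofZero_comp, ofZero_toZero, ofZero_toZero, comp_incl_left, incl_incl]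
    exact H.hom_inv
  · apply level0_hom_ext
    rw [ofZero_comp, ofZero_toZero, ofZero_toZero, comp_incl_right, incl_incl]
    exact H.inv_hom
  · exact (toInf_incl _ _).symm

variable [ShiftFunctor k C]

theorem etaInvInf (x : ℝ) (A : Level0 k C) : IsShiftIso x (etaInvInf x A) :=
  ⟨_, _, isInversePair_eta x A.as, rfl⟩

/-- Dividing by η leaves a homogeneous isomorphism of shift 0, which lies in C₀. In this way
abstract homogeneous isomorphisms are traded for the canonical ones occurring in strict exact
triangles. -/
theorem exists_iso_shObj {x : ℝ} {A B : Level0 k C}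
    {e : (limitFunctor k C).obj A ⟶ (limitFunctor k C).obj B} (he : IsShiftIso x e) :
    ∃ i : A ≅ shObj x B, e = (limitFunctor k C).map i.hom ≫ _root_.etaInvInf x B := by
  obtain ⟨i, hi⟩ := exists_iso ((he.comp (inv (etaInvInf x B))).congr_shift (by simp))
  refine ⟨i, ?_⟩
  rw [← hi]
  simp

end IsShiftIso

end ShiftIso

/-! ## Vanishing at a level, and acyclic objects -/

section Vanishing

variable {k : Type w} [Field k] {C : Type u} [PersistenceCategory.{w, v, u} k C]

/-- The morphism `f` of `C₀` becomes zero at level `r`. -/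
def VanishesAt (r : ℝ) (hr : 0 ≤ r) {A B : Level0 k C} (f : A ⟶ B) : Prop :=
  incl hr (ofZero f) = 0

namespace VanishesAt

variable {r : ℝ} {hr : 0 ≤ r} {A B D : Level0 k C}

theorem comp_right {f : A ⟶ B} (hf : VanishesAt r hr f) (g : B ⟶ D) :
    VanishesAt r hr (f ≫ g) := by
  have h : incl hr (ofZero (f ≫ g)) = incl (add_zero r).le (comp (incl hr (ofZero f)) (ofZero g)) := by
    rw [ofZero_comp, comp_incl_left, incl_incl, incl_incl]
  rw [VanishesAt, h, show incl hr (ofZero f) = 0 from hf]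
  simp

theorem comp_left {g : B ⟶ D} (hg : VanishesAt r hr g) (f : A ⟶ B) :
    VanishesAt r hr (f ≫ g) := by
  have h : incl hr (ofZero (f ≫ g)) = incl (zero_add r).le (comp (ofZero f) (incl hr (ofZero g))) := by
    rw [ofZero_comp, comp_incl_right, incl_incl, incl_incl]
  rw [VanishesAt, h, show incl hr (ofZero g) = 0 from hg]
  simp

theorem add {f g : A ⟶ B} (hf : VanishesAt r hr f) (hg : VanishesAt r hr g) :
    VanishesAt r hr (f + g) := by
  have h : incl hr (ofZero (f + g)) = incl hr (ofZero f) + incl hr (ofZero g) := map_add _ _ _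
  rw [VanishesAt, h, show incl hr (ofZero f) = 0 from hf, show incl hr (ofZero g) = 0 from hg,
    add_zero]

theorem mono {f : A ⟶ B} (hf : VanishesAt r hr f) {s : ℝ} (h : r ≤ s) :
    VanishesAt s (hr.trans h) f := by
  rw [VanishesAt, ← incl_incl hr h, show incl hr (ofZero f) = 0 from hf, map_zero]

end VanishesAt

variable [ShiftFunctor k C]

open ShiftFunctor (eta etaInv)

/-- Precomposition with η_{r,0} is a bijection from Hom r A B to Hom 0 (Σ^r A) B, and it sends the
image of f at level r to η_r followed by f. -/
theorem incl_comp_etaInv_eq_zero_iff (r : ℝ) (hr : 0 ≤ r) {A B : C} (f : Hom k 0 A B) :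
    incl (add_zero (0 : ℝ)).le (comp (incl (neg_nonpos.2 hr) (etaInv r A)) f) = 0 ↔
      incl hr f = 0 := by
  have h₁ : incl (add_zero (0 : ℝ)).le (comp (incl (neg_nonpos.2 hr) (etaInv r A)) f) =
      incl (by linarith : -r + r ≤ 0) (comp (etaInv r A) (incl hr f)) := by
    rw [comp_incl_left, comp_incl_right, incl_incl, incl_incl]
  have h₂ : incl hr f = incl (by linarith : r + 0 ≤ r) (comp (eta r A)
      (incl (add_zero (0 : ℝ)).le (comp (incl (neg_nonpos.2 hr) (etaInv r A)) f))) := by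
    simp only [comp_incl_left, comp_incl_right, incl_incl, (isInversePair_eta r A).comp_assoc']
  constructor
  · intro h
    rw [h₂, h]
    simp
  · intro h
    rw [h₁, h]
    simp

/-- The bridge between persistence and triangulated structure: vanishing at a level becomes
vanishing of a composite in C₀, to which the exact sequences of triangles apply. -/
theorem etaZero_comp_eq_zero_iff (r : ℝ) (hr : 0 ≤ r) {A B : Level0 k C} (f : A ⟶ B) :
    etaZero r hr A ≫ f = 0 ↔ VanishesAt r hr f :=
  incl_comp_etaInv_eq_zero_iff r hr (ofZero f)

/-- Conjugation of a morphism of shift `0` with `η`. -/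
def conjEta (x : ℝ) {A B : C} (f : Hom k 0 A B) :
    Hom k 0 (ShiftFunctor.obj k x A) (ShiftFunctor.obj k x B) :=
  incl (by simp : -x + (0 + x) ≤ 0) (comp (etaInv x A) (comp f (eta x B)))

theorem conjEta_ident (x : ℝ) (A : C) :
    conjEta x (ident (k := k) A) = ident (ShiftFunctor.obj k x A) := by
  rw [conjEta, ident_comp, comp_incl_right, incl_incl]
  exact ShiftFunctor.etaInv_comp_eta x A

theorem shMap_id (x : ℝ) (A : Level0 k C) : shMap x (𝟙 A) = 𝟙 (shObj x A) :=
  conjEta_ident x A.as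

theorem conjEta_comp (x : ℝ) {A B D : C} (f : Hom k 0 A B) (g : Hom k 0 B D) :
    conjEta x (incl (add_zero (0 : ℝ)).le (comp f g)) =
      incl (add_zero (0 : ℝ)).le (comp (conjEta x f) (conjEta x g)) := by
  simp only [conjEta, comp_incl_left, comp_incl_right, comp_assoc, incl_incl,
    (isInversePair_eta x B).comp_assoc']

theorem shMap_comp (x : ℝ) {A B D : Level0 k C} (f : A ⟶ B) (g : B ⟶ D) :
    shMap x (f ≫ g) = shMap x f ≫ shMap x g :=
  conjEta_comp x (ofZero f) (ofZero g)

theorem conjEta_comp_etaInv (x : ℝ) {A B : C} (f : Hom k 0 A B) :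
    comp (conjEta x f) (etaInv x B) = incl (by linarith) (comp (etaInv x A) f) := by
  simp only [conjEta, comp_incl_left, comp_incl_right, comp_assoc, incl_incl,
    (isInversePair_eta x B).comp_eq', comp_ident]

theorem limitFunctor_map_shMap (x : ℝ) {A B : Level0 k C} (f : A ⟶ B) :
    (limitFunctor k C).map (shMap x f) ≫ etaInvInf x B =
      etaInvInf x A ≫ (limitFunctor k C).map f := by
  refine (toInf_comp _ _).symm.trans (Eq.trans ?_ (toInf_comp _ _))
  exact (congrArg toInf (conjEta_comp_etaInv x (ofZero f))).trans (toInf_incl _ _)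

theorem limitFunctor_map_shCancel (x : ℝ) (A : Level0 k C) :
    (limitFunctor k C).map (shCancel x A) = etaInvInf x (shObj (-x) A) ≫ etaInvInf (-x) A :=
  (toInf_incl _ _).trans (toInf_comp _ _)

/-- Every morphism `Σ^r A ⟶ B` is of the form `Σ^r g` for a morphism `g : A ⟶ Σ^{-r} B`. -/
theorem exists_shMap_shCancel (r : ℝ) {A B : Level0 k C} (f : shObj r A ⟶ B) :
    ∃ g : A ⟶ shObj (-r) B, shMap r g ≫ shCancel r B = f := by
  -- The three factors have shifts r, 0 and -r, so the composite has shift 0.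
  refine ⟨toZero (incl (by linarith) (comp (eta r A.as) (comp (ofZero f) (eta (-r) B.as)))), ?_⟩
  have key : ∀ {A B : C} (f : Hom k 0 (ShiftFunctor.obj k r A) B),
      incl (add_zero (0 : ℝ)).le (comp (conjEta r
        (incl (by linarith) (comp (eta r A) (comp f (eta (-r) B)))))
      (incl (by simp : -r + -(-r) ≤ 0)
        (comp (etaInv r (ShiftFunctor.obj k (-r) B)) (etaInv (-r) B)))) = f := by
    intro A B f
    simp only [conjEta, comp_incl_left, comp_incl_right, comp_assoc, incl_incl,
      (isInversePair_eta r A).comp_assoc,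
      (isInversePair_eta r (ShiftFunctor.obj k (-r) B)).comp_assoc',
      (isInversePair_eta (-r) B).comp_eq', comp_ident]
    exact incl_refl _
  exact key (ofZero f)

end Vanishing

/-! ### Acyclic objects: invariance under homogeneous isomorphisms, sums, translation and
extensions. -/

section Acyclic

variable {k : Type w} [Field k] {C : Type u} [PersistenceCategory.{w, v, u} k C]

theorem isAcyclic_iff_vanishesAt_id (r : ℝ) (hr : 0 ≤ r) (K : Level0 k C) :
    IsAcyclic r hr K ↔ VanishesAt r hr (𝟙 K) := Iff.rfl

namespace IsAcyclic

variable {r : ℝ} {hr : 0 ≤ r} {K K' : Level0 k C}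

theorem mono (h : IsAcyclic r hr K) {s : ℝ} (hs : r ≤ s) : IsAcyclic s (hr.trans hs) K :=
  VanishesAt.mono h hs

theorem vanishesAt_left (h : IsAcyclic r hr K) (f : K ⟶ K') : VanishesAt r hr f :=
  Category.id_comp f ▸ VanishesAt.comp_right ((isAcyclic_iff_vanishesAt_id r hr K).1 h) f

theorem vanishesAt_right (h : IsAcyclic r hr K) (f : K' ⟶ K) : VanishesAt r hr f :=
  Category.comp_id f ▸ VanishesAt.comp_left ((isAcyclic_iff_vanishesAt_id r hr K).1 h) f

/-- Conjugating by an inverse pair turns one identity into the other; the shifts -x and x cancel, so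
the level r is unchanged. -/
theorem of_isShiftIso (h : IsAcyclic r hr K) {x : ℝ}
    {e : (limitFunctor k C).obj K' ⟶ (limitFunctor k C).obj K} (he : IsShiftIso x e) :
    IsAcyclic r hr K' := by
  obtain ⟨g, g', H, -⟩ := he
  change Hom k (-x) K'.as K.as at g
  change Hom k x K.as K'.as at g'
  have H' : IsInversePair g g' := H
  have h' : incl hr (ident (k := k) K.as) = 0 := h
  have e₁ : incl hr (ident (k := k) K'.as) =
      incl (by linarith : -x + (r + x) ≤ r) (comp g (comp (incl hr (ident K.as)) g')) := by
    rw [comp_incl_left, ident_comp]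
    simp only [incl_incl, comp_incl_right, H'.comp_eq]
  change incl hr (ident (k := k) K'.as) = 0
  rw [e₁, h']
  simp

theorem of_isZero (h : IsZero K) : IsAcyclic 0 le_rfl K := by
  rw [isAcyclic_iff_vanishesAt_id, h.eq_of_src (𝟙 K) 0]
  exact map_zero _

theorem isZero (h : IsAcyclic 0 le_rfl K) : IsZero K := by
  rw [IsZero.iff_id_eq_zero]
  have : incl le_rfl (ident (k := k) K.as) = 0 := h
  rw [incl_refl] at this
  exact this

theorem of_biprod {S : Level0 k C} (h : IsAcyclic r hr K) (h' : IsAcyclic r hr K')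
    (i : K ⟶ S) (p : S ⟶ K) (i' : K' ⟶ S) (p' : S ⟶ K') (total : p ≫ i + p' ≫ i' = 𝟙 S) :
    IsAcyclic r hr S := by
  rw [isAcyclic_iff_vanishesAt_id, ← total]
  exact ((h.vanishesAt_right p).comp_right i).add ((h'.vanishesAt_right p').comp_right i')

theorem shift [HasShift (Level0 k C) ℤ] [PersistenceTranslation k C]
    (h : IsAcyclic r hr K) (n : ℤ) : IsAcyclic r hr (K⟦n⟧) := by
  have e : ident (k := k) (K⟦n⟧).as = PersistenceTranslation.tr n (ident (k := k) K.as) := by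
    have := PersistenceTranslation.tr_zero (k := k) n (𝟙 K)
    rw [CategoryTheory.Functor.map_id] at this
    exact this.symm
  have h' : incl hr (ident (k := k) K.as) = 0 := h
  change incl hr (ident (k := k) (K⟦n⟧).as) = 0
  rw [e, ← PersistenceTranslation.tr_incl, h', map_zero]

/-- Since `Δ.obj₃` is s-acyclic, η_s of the middle object dies in it and so factors through the
r-acyclic `Δ.obj₁`. Thus η_s vanishes at level r. Cancelling η_{s,0}, which is invertible of shift
-s, gives vanishing of the identity at level r + s. -/
theorem ext [ShiftFunctor k C] [HasZeroObject (Level0 k C)] [HasShift (Level0 k C) ℤ]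
    [∀ n : ℤ, (shiftFunctor (Level0 k C) n).Additive] [Pretriangulated (Level0 k C)]
    {Δ : Triangle (Level0 k C)} (hΔ : Δ ∈ distTriang (Level0 k C)) {s : ℝ} {hs : 0 ≤ s}
    (h₁ : IsAcyclic r hr Δ.obj₁) (h₃ : IsAcyclic s hs Δ.obj₃) :
    IsAcyclic (r + s) (add_nonneg hr hs) Δ.obj₂ := by
  obtain ⟨g, hg⟩ := Triangle.coyoneda_exact₂ Δ hΔ (etaZero s hs Δ.obj₂)
    ((etaZero_comp_eq_zero_iff s hs _).2 (h₃.vanishesAt_right _))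
  have h : VanishesAt r hr (etaZero s hs Δ.obj₂) := by
    rw [hg]
    exact (h₁.vanishesAt_right g).comp_right _
  have h' : incl hr (incl (neg_nonpos.2 hs) (ShiftFunctor.etaInv (k := k) s Δ.obj₂.as)) = 0 := h
  change incl _ (ident (k := k) Δ.obj₂.as) = 0
  have e : incl (add_nonneg hr hs) (ident (k := k) Δ.obj₂.as) = incl (by linarith : s + r ≤ r + s)
      (comp (ShiftFunctor.eta s Δ.obj₂.as)
        (incl hr (incl (neg_nonpos.2 hs) (ShiftFunctor.etaInv (k := k) s Δ.obj₂.as)))) := by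
    rw [incl_incl, comp_incl_right, (isInversePair_eta s Δ.obj₂.as).comp_eq']
    simp only [incl_incl]
  rw [e, h']
  simp

end IsAcyclic

end Acyclic

/-! ## Homogeneous isomorphisms and the translation functor -/

section Translation

variable {k : Type w} [Field k] {C : Type u} [PersistenceCategory.{w, v, u} k C]
  [ShiftFunctor k C] [HasShift (Level0 k C) ℤ] [PersistenceTranslation k C]

open PersistenceTranslation

theorem tr_ident (n : ℤ) (A : C) :
    tr n (ident (k := k) A) = ident (k := k) ((⟨A⟩ : Level0 k C)⟦n⟧).as := by
  have := tr_zero (k := k) n (𝟙 (⟨A⟩ : Level0 k C))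
  rw [CategoryTheory.Functor.map_id] at this
  exact this

theorem IsInversePair.tr {x : ℝ} {A B : C} {h : Hom k (-x) A B} {h' : Hom k x B A}
    (H : IsInversePair h h') (n : ℤ) : IsInversePair (tr n h) (tr n h') := by
  constructor
  · rw [← tr_comp, ← tr_incl, H.hom_inv, tr_ident]
  · rw [← tr_comp, ← tr_incl, H.inv_hom, tr_ident]

theorem IsShiftIso.shift {x : ℝ} {A B : LevelInf k C} {e : A ⟶ B} (he : IsShiftIso x e) (n : ℤ) :
    IsShiftIso x (e⟦n⟧') := by
  obtain ⟨h, h', H, rfl⟩ := he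
  exact ⟨_, _, H.tr n, rfl⟩

/-- The translation of C_∞ is induced from that of C₀ in such a way that this compatibility
isomorphism is the identity. -/
theorem isShiftIso_commShiftIso_hom_app (n : ℤ) (A : Level0 k C) :
    IsShiftIso 0 (((limitFunctor k C).commShiftIso n).hom.app A) :=
  IsShiftIso.id ((limitFunctor k C).obj (A⟦n⟧))

theorem isShiftIso_commShiftIso_inv_app (n : ℤ) (A : Level0 k C) :
    IsShiftIso 0 (((limitFunctor k C).commShiftIso n).inv.app A) :=
  IsShiftIso.id ((limitFunctor k C).obj (A⟦n⟧))

theorem limitFunctor_map_shTr (x : ℝ) (A : Level0 k C) :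
    (limitFunctor k C).map (shTr x A) ≫ ((limitFunctor k C).commShiftIso (1 : ℤ)).hom.app _ =
      etaInvInf x (A⟦(1 : ℤ)⟧) ≫ ((limitFunctor k C).commShiftIso (1 : ℤ)).hom.app A ≫
        (etaInf x A)⟦(1 : ℤ)⟧' := by
  have h₂ : ((limitFunctor k C).commShiftIso (1 : ℤ)).hom.app A ≫ (etaInf x A)⟦(1 : ℤ)⟧' =
      toInf (tr (k := k) 1 (ShiftFunctor.eta x A.as)) :=
    Category.id_comp (X := (limitFunctor k C).obj (A⟦(1 : ℤ)⟧))
      (Y := (limitFunctor k C).obj ((shObj x A)⟦(1 : ℤ)⟧)) _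
  refine Eq.trans ?_ (congrArg (etaInvInf x (A⟦(1 : ℤ)⟧) ≫ ·) h₂).symm
  refine Eq.trans ?_ ((toInf_incl (neg_add_cancel x).le _).trans (toInf_comp _ _))
  exact Category.comp_id (X := (limitFunctor k C).obj (shObj x (A⟦(1 : ℤ)⟧)))
      (Y := (limitFunctor k C).obj ((shObj x A)⟦(1 : ℤ)⟧)) _

end Translation

/-! ## Distinguished triangles -/

section Distinguished

variable {D : Type*} [Category* D] [HasZeroObject D] [HasShift D ℤ] [Preadditive D]
  [∀ n : ℤ, (shiftFunctor D n).Additive] [Pretriangulated D]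

theorem distTriang_of_iso {A B X A' B' X' : D} {u : A ⟶ B} {v : B ⟶ X} {w : X ⟶ A⟦(1 : ℤ)⟧}
    {u' : A' ⟶ B'} {v' : B' ⟶ X'} {w' : X' ⟶ A'⟦(1 : ℤ)⟧}
    (h : Triangle.mk u v w ∈ distTriang D) (e₁ : A' ≅ A) (e₂ : B' ≅ B) (e₃ : X' ≅ X)
    (c₁ : u' ≫ e₂.hom = e₁.hom ≫ u) (c₂ : v' ≫ e₃.hom = e₂.hom ≫ v)
    (c₃ : w' ≫ e₁.hom⟦(1 : ℤ)⟧' = e₃.hom ≫ w) :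
    Triangle.mk u' v' w' ∈ distTriang D :=
  isomorphic_distinguished _ h _ (Triangle.isoMk _ _ e₁ e₂ e₃ c₁ c₂ c₃)

theorem exists_iso_cone {A B X A' B' X' : D} {u : A ⟶ B} {v : B ⟶ X} {w : X ⟶ A⟦(1 : ℤ)⟧}
    {u' : A' ⟶ B'} {v' : B' ⟶ X'} {w' : X' ⟶ A'⟦(1 : ℤ)⟧}
    (h : Triangle.mk u v w ∈ distTriang D) (h' : Triangle.mk u' v' w' ∈ distTriang D)
    (e₁ : A ≅ A') (e₂ : B ≅ B') (c₁ : u ≫ e₂.hom = e₁.hom ≫ u') :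
    ∃ e₃ : X ≅ X', v ≫ e₃.hom = e₂.hom ≫ v' ∧ w ≫ e₁.hom⟦(1 : ℤ)⟧' = e₃.hom ≫ w' := by
  let e := isoTriangleOfIso₁₂ _ _ h h' e₁ e₂ c₁
  exact ⟨Triangle.π₃.mapIso e, e.hom.comm₂, e.hom.comm₃⟩

theorem isZero_of_distTriang_of_isIso₁ {A B X : D} {u : A ⟶ B} {v : B ⟶ X} {w : X ⟶ A⟦(1 : ℤ)⟧}
    (h : Triangle.mk u v w ∈ distTriang D) [hu : IsIso u] : IsZero X :=
  Triangle.isZero₃_of_isIso₁ _ h hu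

theorem distTriang_rot {A B X : D} {u : A ⟶ B} {v : B ⟶ X} {w : X ⟶ A⟦(1 : ℤ)⟧}
    (h : Triangle.mk u v w ∈ distTriang D) :
    Triangle.mk v w (-u⟦(1 : ℤ)⟧') ∈ distTriang D :=
  rot_of_distTriang _ h

end Distinguished

/-! ## `r`-isomorphisms -/

section RIso

variable {k : Type w} [Field k] {C : Type u} [PersistenceCategory.{w, v, u} k C]
  [ShiftFunctor k C] [HasZeroObject (Level0 k C)] [HasShift (Level0 k C) ℤ]
  [∀ n : ℤ, (shiftFunctor (Level0 k C) n).Additive] [Pretriangulated (Level0 k C)]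

theorem IsRIso.mono {r : ℝ} {hr : 0 ≤ r} {A B : Level0 k C} {f : A ⟶ B} (hf : IsRIso r hr f)
    {s : ℝ} (h : r ≤ s) : IsRIso s (hr.trans h) f := by
  obtain ⟨K, v, w, hΔ, hK⟩ := hf
  exact ⟨K, v, w, hΔ, hK.mono h⟩

theorem IsRIso.of_arrow_iso {r : ℝ} {hr : 0 ≤ r} {A B A' B' : Level0 k C} {f : A ⟶ B}
    (hf : IsRIso r hr f) {f' : A' ⟶ B'} (e₁ : A' ≅ A) (e₂ : B' ≅ B)
    (comm : f' ≫ e₂.hom = e₁.hom ≫ f) : IsRIso r hr f' := by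
  obtain ⟨K, v, w, hΔ, hK⟩ := hf
  exact ⟨K, e₂.hom ≫ v, w ≫ e₁.inv⟦(1 : ℤ)⟧',
    distTriang_of_iso hΔ e₁ e₂ (Iso.refl _) comm (by simp) (by simp [← Functor.map_comp]), hK⟩

theorem isRIso_zero_of_isIso {A B : Level0 k C} (f : A ⟶ B) [IsIso f] :
    IsRIso 0 le_rfl f := by
  obtain ⟨K, v, w, h⟩ := distinguished_cocone_triangle f
  exact ⟨K, v, w, h, .of_isZero (isZero_of_distTriang_of_isIso₁ h)⟩

theorem IsRIso.isIso {A B : Level0 k C} {f : A ⟶ B} (hf : IsRIso 0 le_rfl f) : IsIso f := by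
  obtain ⟨K, v, w, h, hK⟩ := hf
  exact (Triangle.isZero₃_iff_isIso₁ _ h).1 hK.isZero

/-- An `r`-isomorphism has a right inverse up to `η_r`. -/
theorem IsRIso.exists_section {r : ℝ} {hr : 0 ≤ r} {A B : Level0 k C} {f : A ⟶ B}
    (hf : IsRIso r hr f) : ∃ g : shObj r B ⟶ A, g ≫ f = etaZero r hr B := by
  obtain ⟨K, v, w, h, hK⟩ := hf
  obtain ⟨g, hg⟩ := Triangle.coyoneda_exact₂ _ h (etaZero r hr B)
    ((etaZero_comp_eq_zero_iff r hr _).2 (hK.vanishesAt_right _))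
  exact ⟨g, hg.symm⟩

/-- By the octahedral axiom the cone of the composite is an extension of the two cones. -/
theorem IsRIso.comp [IsTriangulated (Level0 k C)] {r s : ℝ} {hr : 0 ≤ r} {hs : 0 ≤ s}
    {A B D : Level0 k C} {f : A ⟶ B} {g : B ⟶ D} (hf : IsRIso r hr f) (hg : IsRIso s hs g) :
    IsRIso (r + s) (add_nonneg hr hs) (f ≫ g) := by
  obtain ⟨K₁, v₁, w₁, h₁, hK₁⟩ := hf
  obtain ⟨K₂, v₂, w₂, h₂, hK₂⟩ := hg
  obtain ⟨K, v, w, h⟩ := distinguished_cocone_triangle (f ≫ g)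
  exact ⟨K, v, w, h, IsAcyclic.ext (Triangulated.someOctahedron rfl h₁ h₂ h).mem hK₁ hK₂⟩

/-- The image in `C₀` of an invertible morphism of nonpositive shift `-x`. -/
def IsInversePair.toLevelZero {x : ℝ} (hx : 0 ≤ x) {A B : Level0 k C} {h : Hom k (-x) A.as B.as}
    {h' : Hom k x B.as A.as} (_ : IsInversePair h h') : A ⟶ B :=
  toZero (incl (neg_nonpos.2 hx) h)

theorem IsInversePair.limitFunctor_map_toLevelZero {x : ℝ} (hx : 0 ≤ x) {A B : Level0 k C}
    {h : Hom k (-x) A.as B.as} {h' : Hom k x B.as A.as} (H : IsInversePair h h') :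
    (limitFunctor k C).map (H.toLevelZero hx) = toInf h :=
  toInf_incl _ _

theorem IsInversePair.comp_toLevelZero_eq_zero {x : ℝ} {hx : 0 ≤ x} {A B D : Level0 k C}
    {h : Hom k (-x) A.as B.as} {h' : Hom k x B.as A.as} (H : IsInversePair h h') {f : D ⟶ A}
    (hf : VanishesAt x hx f) : f ≫ H.toLevelZero hx = 0 := by
  have e : incl (add_zero (0 : ℝ)).le (comp (ofZero f) (incl (neg_nonpos.2 hx) h)) =
      incl (add_neg_cancel x).le (comp (incl hx (ofZero f)) h) := by
    rw [comp_incl_left, comp_incl_right, incl_incl, incl_incl]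
  refine Eq.trans e ?_
  rw [show incl hx (ofZero f) = 0 from hf, map_zero, LinearMap.zero_apply, map_zero]

variable [PersistenceTranslation k C]

/-- A section up to η_r makes the image of f an epimorphism. Dually, K[-1] is r-acyclic, so its map
to A is killed by A → Σ^{-r} A; this map therefore factors through f, which makes the image of f a
split monomorphism. -/
theorem IsRIso.isIso_map {r : ℝ} {hr : 0 ≤ r} {A B : Level0 k C}
    {f : A ⟶ B} (hf : IsRIso r hr f) : IsIso ((limitFunctor k C).map f) := by
  obtain ⟨g, hg⟩ := hf.exists_section
  obtain ⟨K, v, w, h, hK⟩ := hf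
  obtain ⟨p, p', H, hp⟩ := (IsShiftIso.etaInvInf (-r) A).inv.congr_shift (neg_neg r)
  let θ : A ⟶ shObj (-r) A := H.toLevelZero hr
  obtain ⟨q, hq⟩ : ∃ q : B ⟶ shObj (-r) A, θ = f ≫ q :=
    Triangle.yoneda_exact₂ _ (inv_rot_of_distTriang _ h) θ
      (H.comp_toLevelZero_eq_zero ((hK.shift (-1)).vanishesAt_left _))
  have h₁ : (limitFunctor k C).map g ≫ (limitFunctor k C).map f = etaInvInf r B := by
    rw [← Functor.map_comp, hg, limitFunctor_map_etaZero]
  have h₂ : (limitFunctor k C).map f ≫ (limitFunctor k C).map q = inv (etaInvInf (-r) A) := by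
    rw [← Functor.map_comp, ← hq, hp]
    exact H.limitFunctor_map_toLevelZero hr
  have : IsSplitMono ((limitFunctor k C).map f) :=
    ⟨⟨(limitFunctor k C).map q ≫ etaInvInf (-r) A, by rw [reassoc_of% h₂]; simp⟩⟩
  have : Epi ((limitFunctor k C).map f) := by
    have : Epi ((limitFunctor k C).map g ≫ (limitFunctor k C).map f) := by
      rw [h₁]; infer_instance
    exact epi_of_epi ((limitFunctor k C).map g) _
  exact isIso_of_epi_of_isSplitMono _

variable [TriangulatedPersistenceCategory k C]

theorem isRIso_etaZero (r : ℝ) (hr : 0 ≤ r) (A : Level0 k C) : IsRIso r hr (etaZero r hr A) :=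
  TriangulatedPersistenceCategory.exists_acyclic_cone r hr A

/-- Up to an isomorphism A ≅ Σ^x B of C₀ this map is η_x^B, whose cone is x-acyclic by axiom. -/
theorem IsInversePair.isRIso_toLevelZero {x : ℝ} (hx : 0 ≤ x) {A B : Level0 k C}
    {h : Hom k (-x) A.as B.as} {h' : Hom k x B.as A.as} (H : IsInversePair h h') :
    IsRIso x hx (H.toLevelZero hx) := by
  have G := isInversePair_eta (k := k) x B.as
  have e₁ : incl (add_zero (0 : ℝ)).le (comp (incl (neg_add_cancel x).le
      (comp h (ShiftFunctor.eta x B.as))) (incl (neg_add_cancel x).le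
      (comp (ShiftFunctor.etaInv x B.as) h'))) = ident (k := k) A.as := by
    simp only [comp_incl_left, comp_incl_right, PersistenceCategory.comp_assoc, incl_incl, G.comp_assoc', H.comp_eq]
    exact incl_refl _
  have e₂ : incl (add_zero (0 : ℝ)).le (comp (incl (neg_add_cancel x).le
      (comp (ShiftFunctor.etaInv x B.as) h')) (incl (neg_add_cancel x).le
      (comp h (ShiftFunctor.eta x B.as)))) = ident (k := k) (ShiftFunctor.obj k x B.as) := by
    simp only [comp_incl_left, comp_incl_right, PersistenceCategory.comp_assoc, incl_incl, H.comp_assoc', G.comp_eq]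
    exact incl_refl _
  have e₃ : incl (add_zero (0 : ℝ)).le (comp (incl (neg_nonpos.2 hx) h) (ident B.as)) =
      incl (add_zero (0 : ℝ)).le (comp (incl (neg_add_cancel x).le
        (comp h (ShiftFunctor.eta x B.as))) (incl (neg_nonpos.2 hx)
          (ShiftFunctor.etaInv x B.as))) := by
    simp only [comp_incl_left, comp_incl_right, PersistenceCategory.comp_assoc, incl_incl, G.comp_eq', comp_ident]
  let i : A ≅ shObj x B :=
    { hom := toZero (incl (neg_add_cancel x).le (comp h (ShiftFunctor.eta x B.as)))
      inv := toZero (incl (neg_add_cancel x).le (comp (ShiftFunctor.etaInv x B.as) h'))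
      hom_inv_id := e₁
      inv_hom_id := e₂ }
  exact (isRIso_etaZero x hx B).of_arrow_iso i (Iso.refl B) e₃

theorem IsRIso.shMap {r : ℝ} {hr : 0 ≤ r} {A B : Level0 k C} {f : A ⟶ B} (hf : IsRIso r hr f)
    (x : ℝ) : IsRIso r hr (shMap x f) := by
  obtain ⟨K, v, w, h, hK⟩ := hf
  exact ⟨_, _, _, TriangulatedPersistenceCategory.shift_distinguished x _ h,
    hK.of_isShiftIso (IsShiftIso.etaInvInf x K)⟩

end RIso

/-! ## The limit category as a Verdier quotient -/

section Verdier

variable {k : Type w} [Field k] {C : Type u} [PersistenceCategory.{w, v, u} k C]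
  [ShiftFunctor k C] [HasZeroObject (Level0 k C)] [HasShift (Level0 k C) ℤ]
  [∀ n : ℤ, (shiftFunctor (Level0 k C) n).Additive] [Pretriangulated (Level0 k C)]
  [PersistenceTranslation k C]

instance : (acyclics k C).IsTriangulated where
  exists_zero :=
    ⟨_, isZero_zero (Level0 k C), 0, le_rfl, .of_isZero (isZero_zero (Level0 k C))⟩
  isStableUnderShiftBy n := ⟨fun _ ⟨r, hr, h⟩ => ⟨r, hr, h.shift n⟩⟩
  ext₂' _ hΔ := by
    rintro ⟨r, hr, h₁⟩ ⟨s, hs, h₃⟩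
    exact ObjectProperty.le_isoClosure _ _ ⟨_, _, IsAcyclic.ext hΔ h₁ h₃⟩

theorem trW_acyclics_iff {A B : Level0 k C} (f : A ⟶ B) :
    (acyclics k C).trW f ↔ ∃ (r : ℝ) (hr : 0 ≤ r), IsRIso r hr f := by
  constructor
  · rintro ⟨K, v, w, h, r, hr, hK⟩
    exact ⟨r, hr, K, v, w, h, hK⟩
  · rintro ⟨r, hr, K, v, w, h, hK⟩
    exact ⟨K, v, w, h, r, hr, hK⟩

theorem trW_acyclics_isInvertedBy : (acyclics k C).trW.IsInvertedBy (limitFunctor k C) := by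
  intro A B f hf
  obtain ⟨r, hr, h⟩ := (trW_acyclics_iff f).1 hf
  exact h.isIso_map

/-- Equality in the direct limit is equality at a finite level, hence equality after some η_r. This
yields faithfulness on the Verdier quotient. -/
theorem limitFunctor_map_eq_iff {A B : Level0 k C} (f g : A ⟶ B) :
    (limitFunctor k C).map f = (limitFunctor k C).map g ↔
      ∃ (r : ℝ) (hr : 0 ≤ r), etaZero r hr A ≫ f = etaZero r hr A ≫ g := by
  constructor
  · intro h
    obtain ⟨r, hr, e⟩ := (toInf_eq_toInf_iff (ofZero f) (ofZero g)).1 h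
    refine ⟨r, hr, ?_⟩
    rw [← sub_eq_zero, ← Preadditive.comp_sub, etaZero_comp_eq_zero_iff]
    exact (map_sub (incl hr) (ofZero f) (ofZero g)).trans (sub_eq_zero.2 e)
  · rintro ⟨r, hr, e⟩
    have := congrArg (limitFunctor k C).map e
    rw [Functor.map_comp, Functor.map_comp, limitFunctor_map_etaZero] at this
    exact (cancel_epi (etaInvInf r A)).1 this

variable [TriangulatedPersistenceCategory k C]

instance : IsTriangulated (Level0 k C) :=
  TriangulatedPersistenceCategory.isTriangulated (k := k)

theorem trW_acyclics_etaZero (r : ℝ) (hr : 0 ≤ r) (A : Level0 k C) :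
    (acyclics k C).trW (etaZero r hr A) :=
  (trW_acyclics_iff _).2 ⟨r, hr, isRIso_etaZero r hr A⟩

instance : (limitFunctor k C).IsLocalization (acyclics k C).trW := by
  let W := (acyclics k C).trW
  let F := Localization.lift (limitFunctor k C) trW_acyclics_isInvertedBy W.Q
  let e : W.Q ⋙ F ≅ limitFunctor k C :=
    Localization.fac (limitFunctor k C) trW_acyclics_isInvertedBy W.Q
  have hQ (r : ℝ) (hr : 0 ≤ r) (A : Level0 k C) : IsIso (W.Q.map (etaZero r hr A)) :=
    Localization.inverts W.Q W _ (trW_acyclics_etaZero r hr A)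
  have : W.Q.EssSurj := Localization.essSurj W.Q W
  have : F.Faithful := by
    -- The calculus of fractions reduces faithfulness to pairs of morphisms coming from C₀.
    refine Functor.faithful_of_comp_of_hasLeftCalculusOfFractions W.Q W F ?_
    intro A B f g h
    have h' : (limitFunctor k C).map f = (limitFunctor k C).map g := by
      rw [← cancel_epi (e.hom.app A), ← e.hom.naturality, ← e.hom.naturality]
      exact congrArg (· ≫ e.hom.app B) h
    obtain ⟨r, hr, h''⟩ := (limitFunctor_map_eq_iff f g).1 h'
    rw [← cancel_epi (W.Q.map (etaZero r hr A)), ← Functor.map_comp, h'', Functor.map_comp]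
  have : F.Full := by
    refine F.full_of_comp_essSurj W.Q fun A B φ => ?_
    -- The preimage is the fraction formed by the inverse of η_r followed by f.
    obtain ⟨r, hr, f, hf⟩ := exists_limitFunctor_map (e.inv.app A ≫ φ ≫ e.hom.app B)
    refine ⟨inv (W.Q.map (etaZero r hr A)) ≫ W.Q.map f, ?_⟩
    have he {X Y : Level0 k C} (g : X ⟶ Y) :
        F.map (W.Q.map g) = e.hom.app X ≫ (limitFunctor k C).map g ≫ e.inv.app Y :=
      ((Iso.eq_comp_inv (e.app Y)).2 (e.hom.naturality g)).trans (Category.assoc _ _ _)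
    have hφ : φ = e.hom.app A ≫ etaInf r A ≫ (limitFunctor k C).map f ≫ e.inv.app B := by
      have h₁ := (Iso.inv_comp_eq (e.app A)).1 hf
      have h₂ := (Iso.eq_comp_inv (e.app B)).2 h₁
      exact h₂.trans (by simp)
    rw [← cancel_epi (F.map (W.Q.map (etaZero r hr A))), ← F.map_comp, IsIso.hom_inv_id_assoc, hφ,
      he, he, limitFunctor_map_etaZero]
    simp only [Category.assoc]
    congr 1
    refine Eq.trans ?_ (congrArg (etaInvInf r A ≫ ·) (Iso.inv_hom_id_assoc (e.app A) _).symm)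
    exact (by rw [← Category.assoc, etaInvInf_etaInf, Category.id_comp] :
      (limitFunctor k C).map f ≫ e.inv.app B =
        etaInvInf r A ≫ etaInf r A ≫ (limitFunctor k C).map f ≫ e.inv.app B)
  have : F.EssSurj := ⟨fun A => ⟨W.Q.obj A.toLevel0, ⟨e.app A.toLevel0⟩⟩⟩
  have : F.IsEquivalence := {}
  exact Functor.IsLocalization.of_equivalence_target W.Q W _ F.asEquivalence e

noncomputable instance : Pretriangulated (LevelInf k C) :=
  Triangulated.Localization.pretriangulated (limitFunctor k C) (acyclics k C).trW

instance : (limitFunctor k C).IsTriangulated :=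
  Triangulated.Localization.isTriangulated_functor (limitFunctor k C) (acyclics k C).trW

instance : IsTriangulated (LevelInf k C) :=
  Triangulated.Localization.isTriangulated (limitFunctor k C) (acyclics k C).trW

end Verdier

/-! ## Direct sums of triangles and of `r`-isomorphisms -/

section Biprod

variable {D : Type*} [Category* D] [Preadditive D]

/-- `S` is a direct sum of `X` and `Y`, with inclusions `i`, `j` and projections `p`, `q`. -/
structure IsBiprod {X Y S : D} (i : X ⟶ S) (p : S ⟶ X) (j : Y ⟶ S) (q : S ⟶ Y) : Prop where
  inl_fst : i ≫ p = 𝟙 X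
  inr_snd : j ≫ q = 𝟙 Y
  inl_snd : i ≫ q = 0
  inr_fst : j ≫ p = 0
  total : p ≫ i + q ≫ j = 𝟙 S

namespace IsBiprod

theorem symm {X Y S : D} {i : X ⟶ S} {p : S ⟶ X} {j : Y ⟶ S} {q : S ⟶ Y}
    (h : IsBiprod i p j q) : IsBiprod j q i p :=
  ⟨h.inr_snd, h.inl_fst, h.inr_fst, h.inl_snd, by rw [add_comm, h.total]⟩

theorem of_isBilimit {X Y : D} {b : BinaryBicone X Y} (hb : b.IsBilimit) :
    IsBiprod b.inl b.fst b.inr b.snd :=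
  ⟨b.inl_fst, b.inr_snd, b.inl_snd, b.inr_fst, IsBilimit.binary_total hb⟩

theorem of_isZero_left {Z X : D} (hZ : IsZero Z) :
    IsBiprod (0 : Z ⟶ X) (0 : X ⟶ Z) (𝟙 X) (𝟙 X) :=
  ⟨hZ.eq_of_src _ _, by simp, by simp, by simp, by simp⟩

theorem map {E : Type*} [Category* E] [Preadditive E] (F : D ⥤ E) [F.Additive]
    {X Y S : D} {i : X ⟶ S} {p : S ⟶ X} {j : Y ⟶ S} {q : S ⟶ Y} (h : IsBiprod i p j q) :
    IsBiprod (F.map i) (F.map p) (F.map j) (F.map q) := by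
  refine ⟨?_, ?_, ?_, ?_, ?_⟩ <;> simp only [← F.map_comp, ← F.map_add]
  · rw [h.inl_fst, F.map_id]
  · rw [h.inr_snd, F.map_id]
  · rw [h.inl_snd, F.map_zero]
  · rw [h.inr_fst, F.map_zero]
  · rw [h.total, F.map_id]

variable {X Y : D}

/-- A direct sum is a product. -/
theorem exists_iso_pi (F : Bool → D) [HasProduct F] {S : D} {i : F true ⟶ S} {p : S ⟶ F true}
    {j : F false ⟶ S} {q : S ⟶ F false} (h : IsBiprod i p j q) :
    ∃ e : S ≅ ∏ᶜ F, e.hom ≫ Pi.π F true = p ∧ e.hom ≫ Pi.π F false = q := by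
  let f : S ⟶ ∏ᶜ F := Pi.lift (fun b => match b with | true => p | false => q)
  have h₁ : f ≫ Pi.π F true = p := Pi.lift_π _ _
  have h₂ : f ≫ Pi.π F false = q := Pi.lift_π _ _
  refine ⟨⟨f, Pi.π F true ≫ i + Pi.π F false ≫ j, ?_, ?_⟩, h₁, h₂⟩
  · rw [Preadditive.comp_add, reassoc_of% h₁, reassoc_of% h₂, h.total]
  · refine Pi.hom_ext _ _ fun b => ?_
    cases b
    · simp [h₂, h.inl_snd, h.inr_snd]
    · simp [h₁, h.inl_fst, h.inr_fst]

end IsBiprod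

/-- The direct sum of two morphisms. -/
def biprodMap {X Y S X' Y' S' : D} (p : S ⟶ X) (q : S ⟶ Y) (i' : X' ⟶ S') (j' : Y' ⟶ S')
    (f : X ⟶ X') (g : Y ⟶ Y') : S ⟶ S' :=
  p ≫ f ≫ i' + q ≫ g ≫ j'

end Biprod

/-! ### Direct sums of exact triangles. -/

section BiprodTriangle

open scoped ZeroObject

variable {D : Type*} [Category* D] [HasZeroObject D] [HasShift D ℤ] [Preadditive D]
  [∀ n : ℤ, (shiftFunctor D n).Additive] [Pretriangulated D]

/-- A direct sum is a product indexed by `Bool`, and products of exact triangles are exact. -/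
theorem biprod_distTriang (T : Bool → Triangle D) (hT : ∀ b, T b ∈ distTriang D) {S₁ S₂ S₃ : D}
    {i₁ : (T true).obj₁ ⟶ S₁} {p₁ : S₁ ⟶ (T true).obj₁}
    {j₁ : (T false).obj₁ ⟶ S₁} {q₁ : S₁ ⟶ (T false).obj₁}
    {i₂ : (T true).obj₂ ⟶ S₂} {p₂ : S₂ ⟶ (T true).obj₂}
    {j₂ : (T false).obj₂ ⟶ S₂} {q₂ : S₂ ⟶ (T false).obj₂}
    {i₃ : (T true).obj₃ ⟶ S₃} {p₃ : S₃ ⟶ (T true).obj₃}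
    {j₃ : (T false).obj₃ ⟶ S₃} {q₃ : S₃ ⟶ (T false).obj₃}
    (h₁ : IsBiprod i₁ p₁ j₁ q₁) (h₂ : IsBiprod i₂ p₂ j₂ q₂) (h₃ : IsBiprod i₃ p₃ j₃ q₃) :
    Triangle.mk (biprodMap p₁ q₁ i₂ j₂ (T true).mor₁ (T false).mor₁)
      (biprodMap p₂ q₂ i₃ j₃ (T true).mor₂ (T false).mor₂)
      (biprodMap p₃ q₃ (i₁⟦(1 : ℤ)⟧') (j₁⟦(1 : ℤ)⟧') (T true).mor₃ (T false).mor₃) ∈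
        distTriang D := by
  obtain ⟨e₁, hp₁, hq₁⟩ := h₁.exists_iso_pi (fun b => (T b).obj₁)
  obtain ⟨e₂, hp₂, hq₂⟩ := h₂.exists_iso_pi (fun b => (T b).obj₂)
  obtain ⟨e₃, hp₃, hq₃⟩ := h₃.exists_iso_pi (fun b => (T b).obj₃)
  have h₁' := h₁.map (shiftFunctor D (1 : ℤ))
  refine distTriang_of_iso (productTriangle_distinguished T hT) e₁ e₂ e₃ ?_ ?_ ?_
  · refine Pi.hom_ext _ _ fun b => ?_
    cases b
    · simp [biprodMap, hq₂, h₂.inl_snd, h₂.inr_snd, reassoc_of% hq₁]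
    · simp [biprodMap, hp₂, h₂.inl_fst, h₂.inr_fst, reassoc_of% hp₁]
  · refine Pi.hom_ext _ _ fun b => ?_
    cases b
    · simp [biprodMap, hq₃, h₃.inl_snd, h₃.inr_snd, reassoc_of% hq₂]
    · simp [biprodMap, hp₃, h₃.inl_fst, h₃.inr_fst, reassoc_of% hp₂]
  -- The third map of the product triangle contains the inverse of the comparison from T of the
  -- product to the product of the T's. It is moved to the other side so that components can be
  -- compared.
  · rw [← Category.assoc, IsIso.eq_comp_inv]
    refine Pi.hom_ext _ _ fun b => ?_
    cases b
    · simp [biprodMap, ← Functor.map_comp, hq₁, reassoc_of% hq₃, h₁.inl_snd, h₁.inr_snd]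
    · simp [biprodMap, ← Functor.map_comp, hp₁, reassoc_of% hp₃, h₁.inl_fst, h₁.inr_fst]

/-- The direct sum of two distinguished triangles is distinguished. -/
theorem distTriang_biprod {A B X A' B' X' S₁ S₂ S₃ : D}
    {u : A ⟶ B} {v : B ⟶ X} {w : X ⟶ A⟦(1 : ℤ)⟧} {u' : A' ⟶ B'} {v' : B' ⟶ X'}
    {w' : X' ⟶ A'⟦(1 : ℤ)⟧} (h : Triangle.mk u v w ∈ distTriang D)
    (h' : Triangle.mk u' v' w' ∈ distTriang D)
    {i₁ : A ⟶ S₁} {p₁ : S₁ ⟶ A} {j₁ : A' ⟶ S₁} {q₁ : S₁ ⟶ A'}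
    {i₂ : B ⟶ S₂} {p₂ : S₂ ⟶ B} {j₂ : B' ⟶ S₂} {q₂ : S₂ ⟶ B'}
    {i₃ : X ⟶ S₃} {p₃ : S₃ ⟶ X} {j₃ : X' ⟶ S₃} {q₃ : S₃ ⟶ X'}
    (h₁ : IsBiprod i₁ p₁ j₁ q₁) (h₂ : IsBiprod i₂ p₂ j₂ q₂) (h₃ : IsBiprod i₃ p₃ j₃ q₃) :
    Triangle.mk (biprodMap p₁ q₁ i₂ j₂ u u') (biprodMap p₂ q₂ i₃ j₃ v v')
      (biprodMap p₃ q₃ (i₁⟦(1 : ℤ)⟧') (j₁⟦(1 : ℤ)⟧') w w') ∈ distTriang D := by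
  let T : Bool → Triangle D := fun b => match b with
    | true => Triangle.mk u v w
    | false => Triangle.mk u' v' w'
  have hT : ∀ b, T b ∈ distTriang D := by
    rintro (_ | _)
    exacts [h', h]
  exact biprod_distTriang T hT h₁ h₂ h₃

/-- The triangle `X ⊕ Δ : A ⟶ X ⊕ B ⟶ X ⊕ E ⟶ TA` is distinguished if `Δ` is. -/
theorem distTriang_biprod_left {A B E X S₂ S₃ : D} {u : A ⟶ B} {v : B ⟶ E}
    {w : E ⟶ A⟦(1 : ℤ)⟧} (h : Triangle.mk u v w ∈ distTriang D)
    {i₂ : X ⟶ S₂} {p₂ : S₂ ⟶ X} {j₂ : B ⟶ S₂} {q₂ : S₂ ⟶ B}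
    {i₃ : X ⟶ S₃} {p₃ : S₃ ⟶ X} {j₃ : E ⟶ S₃} {q₃ : S₃ ⟶ E}
    (h₂ : IsBiprod i₂ p₂ j₂ q₂) (h₃ : IsBiprod i₃ p₃ j₃ q₃) :
    Triangle.mk (u ≫ j₂) (p₂ ≫ i₃ + q₂ ≫ v ≫ j₃) (q₃ ≫ w) ∈ distTriang D := by
  -- The summand at the first vertex is zero, so A itself serves as the direct sum there.
  have h' : Triangle.mk (0 : (0 : D) ⟶ X) (𝟙 X) (0 : X ⟶ (0 : D)⟦(1 : ℤ)⟧) ∈ distTriang D :=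
    contractible_distinguished₁ X
  have := distTriang_biprod h' h (IsBiprod.of_isZero_left (isZero_zero D)) h₂ h₃
  simpa [biprodMap] using this

end BiprodTriangle

section BiprodRIso

variable {k : Type w} [Field k] {C : Type u} [PersistenceCategory.{w, v, u} k C]
  [HasZeroObject (Level0 k C)] [HasShift (Level0 k C) ℤ]
  [∀ n : ℤ, (shiftFunctor (Level0 k C) n).Additive] [Pretriangulated (Level0 k C)]

theorem IsRIso.biprod {r : ℝ} {hr : 0 ≤ r} {A A' B B' S S' : Level0 k C} {f : A ⟶ B}
    {g : A' ⟶ B'} (hf : IsRIso r hr f) (hg : IsRIso r hr g)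
    {i : A ⟶ S} {p : S ⟶ A} {j : A' ⟶ S} {q : S ⟶ A'} (h : IsBiprod i p j q)
    {i' : B ⟶ S'} {p' : S' ⟶ B} {j' : B' ⟶ S'} {q' : S' ⟶ B'} (h' : IsBiprod i' p' j' q') :
    IsRIso r hr (biprodMap p q i' j' f g) := by
  obtain ⟨K₁, v₁, w₁, h₁, hK₁⟩ := hf
  obtain ⟨K₂, v₂, w₂, h₂, hK₂⟩ := hg
  have H := IsBiprod.of_isBilimit (BinaryBiproduct.isBilimit K₁ K₂)
  exact ⟨K₁ ⊞ K₂, _, _, distTriang_biprod h₁ h₂ h h' H, hK₁.of_biprod hK₂ _ _ _ _ H.total⟩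

end BiprodRIso

/-! ## Homogeneous `r`-isomorphisms of the limit category -/

section ShiftRIso

variable {k : Type w} [Field k] {C : Type u} [PersistenceCategory.{w, v, u} k C]
  [ShiftFunctor k C] [HasZeroObject (Level0 k C)] [HasShift (Level0 k C) ℤ]
  [∀ n : ℤ, (shiftFunctor (Level0 k C) n).Additive] [Pretriangulated (Level0 k C)]

/-- `e` is, up to homogeneous isomorphisms of total shift `-x`, the class of an
`r`-isomorphism of `C₀`. -/
def IsShiftRIso (r : ℝ) (hr : 0 ≤ r) (x : ℝ) {A : Level0 k C} {B : LevelInf k C}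
    (e : (limitFunctor k C).obj A ⟶ B) : Prop :=
  ∃ (A' : Level0 k C) (φ : A ⟶ A') (f : (limitFunctor k C).obj A' ⟶ B),
    IsRIso r hr φ ∧ IsShiftIso x f ∧ e = (limitFunctor k C).map φ ≫ f

theorem IsShiftIso.isShiftRIso {x : ℝ} {A : Level0 k C} {B : LevelInf k C}
    {e : (limitFunctor k C).obj A ⟶ B} (he : IsShiftIso x e) : IsShiftRIso 0 le_rfl x e :=
  ⟨A, 𝟙 A, e, isRIso_zero_of_isIso _, he, by simp⟩

theorem IsShiftRIso.comp_isShiftIso {r : ℝ} {hr : 0 ≤ r} {x y : ℝ} {A : Level0 k C}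
    {B D : LevelInf k C} {e : (limitFunctor k C).obj A ⟶ B} (he : IsShiftRIso r hr x e)
    {f : B ⟶ D} (hf : IsShiftIso y f) : IsShiftRIso r hr (x + y) (e ≫ f) := by
  obtain ⟨A', φ, g, hφ, hg, rfl⟩ := he
  exact ⟨A', φ, g ≫ f, hφ, hg.comp hf, by simp⟩

theorem IsShiftRIso.congr_shift {r : ℝ} {hr : 0 ≤ r} {x y : ℝ} {A : Level0 k C}
    {B : LevelInf k C} {e : (limitFunctor k C).obj A ⟶ B} (he : IsShiftRIso r hr x e)
    (h : x = y) : IsShiftRIso r hr y e := h ▸ he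

theorem IsShiftRIso.map_comp [IsTriangulated (Level0 k C)] {r s : ℝ} {hr : 0 ≤ r} {hs : 0 ≤ s}
    {x : ℝ} {A A' : Level0 k C} {B : LevelInf k C} {φ : A ⟶ A'} (hφ : IsRIso s hs φ)
    {e : (limitFunctor k C).obj A' ⟶ B} (he : IsShiftRIso r hr x e) :
    IsShiftRIso (s + r) (add_nonneg hs hr) x ((limitFunctor k C).map φ ≫ e) := by
  obtain ⟨A'', φ', g, hφ', hg, rfl⟩ := he
  exact ⟨A'', φ ≫ φ', g, hφ.comp hφ', hg, by simp⟩

theorem IsShiftRIso.exists_shObj {r : ℝ} {hr : 0 ≤ r} {x : ℝ} {A B : Level0 k C}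
    {e : (limitFunctor k C).obj A ⟶ (limitFunctor k C).obj B} (he : IsShiftRIso r hr x e) :
    ∃ φ : A ⟶ shObj x B, IsRIso r hr φ ∧ e = (limitFunctor k C).map φ ≫ etaInvInf x B := by
  obtain ⟨A', φ, f, hφ, hf, rfl⟩ := he
  obtain ⟨i, rfl⟩ := hf.exists_iso_shObj
  exact ⟨φ ≫ i.hom, hφ.of_arrow_iso (Iso.refl _) i.symm (by simp), by simp⟩

/-- Used to compare two models of one object of C_∞ inside C₀, once their shifts agree. -/
theorem IsShiftRIso.exists_map {r : ℝ} {hr : 0 ≤ r} {A B : Level0 k C}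
    {e : (limitFunctor k C).obj A ⟶ (limitFunctor k C).obj B} (he : IsShiftRIso r hr 0 e) :
    ∃ φ : A ⟶ B, IsRIso r hr φ ∧ e = (limitFunctor k C).map φ := by
  obtain ⟨A', φ, f, hφ, hf, rfl⟩ := he
  obtain ⟨i, rfl⟩ := hf.exists_iso
  exact ⟨φ ≫ i.hom, hφ.of_arrow_iso (Iso.refl _) i.symm (by simp), by simp⟩

variable [PersistenceTranslation k C]

theorem IsShiftRIso.isIso {r : ℝ} {hr : 0 ≤ r} {x : ℝ} {A : Level0 k C}
    {B : LevelInf k C} {e : (limitFunctor k C).obj A ⟶ B} (he : IsShiftRIso r hr x e) :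
    IsIso e := by
  obtain ⟨A', φ, f, hφ, hf, rfl⟩ := he
  have := hφ.isIso_map
  have := hf.isIso
  infer_instance

variable [TriangulatedPersistenceCategory k C]

/-- Naturality of η moves the homogeneous isomorphism past φ at the cost of replacing φ by Σ^y φ,
which is again an r-isomorphism because Σ^y is triangulated. -/
theorem IsShiftRIso.isShiftIso_comp {r : ℝ} {hr : 0 ≤ r} {x y : ℝ} {A A' : Level0 k C}
    {B : LevelInf k C} {e : (limitFunctor k C).obj A ⟶ B} (he : IsShiftRIso r hr x e)
    {f : (limitFunctor k C).obj A' ⟶ (limitFunctor k C).obj A} (hf : IsShiftIso y f) :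
    IsShiftRIso r hr (y + x) (f ≫ e) := by
  obtain ⟨A'', φ, g, hφ, hg, rfl⟩ := he
  obtain ⟨i, rfl⟩ := hf.exists_iso_shObj
  refine ⟨shObj y A'', i.hom ≫ shMap y φ, etaInvInf y A'' ≫ g,
    (hφ.shMap y).of_arrow_iso i (Iso.refl _) (by simp),
    (IsShiftIso.etaInvInf y A'').comp hg, ?_⟩
  rw [Functor.map_comp, Category.assoc, Category.assoc, ← reassoc_of% limitFunctor_map_shMap]

/-- The identity is an `r`-isomorphism of any shift between `-r` and `0`. -/
theorem isShiftRIso_id {r : ℝ} (hr : 0 ≤ r) {x : ℝ} (hx : x ≤ 0) (hxr : -r ≤ x)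
    (A : Level0 k C) : IsShiftRIso r hr x (𝟙 ((limitFunctor k C).obj A)) := by
  -- As x ≤ 0, the inverse of η_{x,0} has nonpositive shift and so is the image of a morphism of C₀;
  -- its cone is (-x)-acyclic, and -x ≤ r.
  obtain ⟨p, p', H, hp⟩ := (IsShiftIso.etaInvInf x A).inv
  let θ : A ⟶ shObj x A := H.toLevelZero (neg_nonneg.2 hx)
  have hθ : (limitFunctor k C).map θ = inv (etaInvInf x A) :=
    (H.limitFunctor_map_toLevelZero (neg_nonneg.2 hx)).trans hp.symm
  exact ⟨shObj x A, θ, etaInvInf x A,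
    (H.isRIso_toLevelZero (neg_nonneg.2 hx)).mono (by linarith),
    IsShiftIso.etaInvInf x A, by rw [hθ, IsIso.inv_hom_id]⟩

end ShiftRIso

/-! ### Additivity of Σ^x, and direct sums of homogeneous r-isomorphisms. -/

section ShiftFunctorZero

variable (k : Type w) [Field k] (C : Type u) [PersistenceCategory.{w, v, u} k C]
  [ShiftFunctor k C]

variable {k C} in
theorem shMap_add (x : ℝ) {A B : Level0 k C} (f g : A ⟶ B) :
    shMap x (f + g) = shMap x f + shMap x g := by
  have h : ∀ {A B : C} (f g : Hom k 0 A B), conjEta x (f + g) = conjEta x f + conjEta x g := by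
    intro A B f g
    simp only [conjEta, map_add, LinearMap.add_apply]
  exact h (ofZero f) (ofZero g)

/-- The functor `Σ^x` on `C₀`. -/
def shFunctor (x : ℝ) : Level0 k C ⥤ Level0 k C where
  obj := shObj x
  map := shMap x
  map_id := shMap_id x
  map_comp := shMap_comp x

instance (x : ℝ) : (shFunctor k C x).Additive where
  map_add := shMap_add x _ _

end ShiftFunctorZero

section ShiftRIsoBiprod

variable {k : Type w} [Field k] {C : Type u} [PersistenceCategory.{w, v, u} k C]
  [ShiftFunctor k C] [HasZeroObject (Level0 k C)] [HasShift (Level0 k C) ℤ]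
  [∀ n : ℤ, (shiftFunctor (Level0 k C) n).Additive] [Pretriangulated (Level0 k C)]
  [PersistenceTranslation k C] [TriangulatedPersistenceCategory k C]

theorem IsShiftRIso.biprod {r : ℝ} {hr : 0 ≤ r} {x : ℝ} {A A' B B' S S' : Level0 k C}
    {e : (limitFunctor k C).obj A ⟶ (limitFunctor k C).obj B}
    {f : (limitFunctor k C).obj A' ⟶ (limitFunctor k C).obj B'}
    (he : IsShiftRIso r hr x e) (hf : IsShiftRIso r hr x f)
    {i : A ⟶ S} {p : S ⟶ A} {j : A' ⟶ S} {q : S ⟶ A'} (h : IsBiprod i p j q)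
    {i' : B ⟶ S'} {p' : S' ⟶ B} {j' : B' ⟶ S'} {q' : S' ⟶ B'} (h' : IsBiprod i' p' j' q') :
    IsShiftRIso r hr x (biprodMap ((limitFunctor k C).map p) ((limitFunctor k C).map q)
      ((limitFunctor k C).map i') ((limitFunctor k C).map j') e f) := by
  obtain ⟨φ, hφ, rfl⟩ := he.exists_shObj
  obtain ⟨ψ, hψ, rfl⟩ := hf.exists_shObj
  -- Both summands have the same shift x, so their targets add up to Σ^x S'.
  have H : IsBiprod (shMap x i') (shMap x p') (shMap x j') (shMap x q') :=
    h'.map (shFunctor k C x)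
  refine ⟨shObj x S', biprodMap p q (shMap x i') (shMap x j') φ ψ, etaInvInf x S',
    hφ.biprod hψ h H, IsShiftIso.etaInvInf x S', ?_⟩
  simp only [biprodMap, Functor.map_add, Functor.map_comp, Preadditive.add_comp, Category.assoc,
    limitFunctor_map_shMap]

end ShiftRIsoBiprod

/-! ## Models of triangles of the limit category -/

section Model

variable {k : Type w} [Field k] {C : Type u} [PersistenceCategory.{w, v, u} k C]
  [ShiftFunctor k C] [HasZeroObject (Level0 k C)] [HasShift (Level0 k C) ℤ]
  [∀ n : ℤ, (shiftFunctor (Level0 k C) n).Additive] [Pretriangulated (Level0 k C)]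
  [PersistenceTranslation k C]

/-- The triangle `(a, b, c)` of `C_∞` has a model of weight `r` and shifts `x`, `y`, `z`: an
exact triangle of `C₀` whose image in `C_∞` is isomorphic to it, through homogeneous isomorphisms
for the first two objects, and a homogeneous `r`-isomorphism for the third. -/
def HasModel (r : ℝ) (hr : 0 ≤ r) (x y z : ℝ) {A B X : LevelInf k C} (a : A ⟶ B) (b : B ⟶ X)
    (c : X ⟶ A⟦(1 : ℤ)⟧) : Prop :=
  ∃ (A' B' X' : Level0 k C) (u : A' ⟶ B') (v : B' ⟶ X') (w : X' ⟶ A'⟦(1 : ℤ)⟧)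
    (e₁ : (limitFunctor k C).obj A' ⟶ A) (e₂ : (limitFunctor k C).obj B' ⟶ B)
    (e₃ : (limitFunctor k C).obj X' ⟶ X),
    Triangle.mk u v w ∈ distTriang (Level0 k C) ∧
    IsShiftIso x e₁ ∧ IsShiftIso y e₂ ∧ IsShiftRIso r hr z e₃ ∧
    (limitFunctor k C).map u ≫ e₂ = e₁ ≫ a ∧
    (limitFunctor k C).map v ≫ e₃ = e₂ ≫ b ∧
    (limitFunctor k C).map w ≫ ((limitFunctor k C).commShiftIso (1 : ℤ)).hom.app A' ≫
      e₁⟦(1 : ℤ)⟧' = e₃ ≫ c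

theorem commShiftIso_hom_app_naturality {A B : Level0 k C} (f : A ⟶ B) :
    (limitFunctor k C).map (f⟦(1 : ℤ)⟧') ≫ ((limitFunctor k C).commShiftIso (1 : ℤ)).hom.app B =
      ((limitFunctor k C).commShiftIso (1 : ℤ)).hom.app A ≫
        ((limitFunctor k C).map f)⟦(1 : ℤ)⟧' :=
  ((limitFunctor k C).commShiftIso (1 : ℤ)).hom.naturality f

variable [TriangulatedPersistenceCategory k C]

/-- Since Σ^s is triangulated, a model can be shifted as a whole; only the differences of x, y and z
carry information. -/
theorem HasModel.shift {r : ℝ} {hr : 0 ≤ r} {x y z : ℝ} {A B X : LevelInf k C} {a : A ⟶ B}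
    {b : B ⟶ X} {c : X ⟶ A⟦(1 : ℤ)⟧} (h : HasModel r hr x y z a b c) (s : ℝ) :
    HasModel r hr (s + x) (s + y) (s + z) a b c := by
  obtain ⟨A', B', X', u, v, w, e₁, e₂, e₃, hΔ, h₁, h₂, h₃, c₁, c₂, c₃⟩ := h
  refine ⟨_, _, _, _, _, _, etaInvInf s A' ≫ e₁, etaInvInf s B' ≫ e₂, etaInvInf s X' ≫ e₃,
    TriangulatedPersistenceCategory.shift_distinguished s _ hΔ,
    (IsShiftIso.etaInvInf s A').comp h₁, (IsShiftIso.etaInvInf s B').comp h₂,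
    h₃.isShiftIso_comp (IsShiftIso.etaInvInf s X'), ?_, ?_, ?_⟩
  · exact ((reassoc_of% (limitFunctor_map_shMap s u)) e₂).trans (by rw [c₁, Category.assoc])
  · exact ((reassoc_of% (limitFunctor_map_shMap s v)) e₃).trans (by rw [c₂, Category.assoc])
  · have h : (limitFunctor k C).map (shMap s w ≫ shTr s A') ≫
        ((limitFunctor k C).commShiftIso (1 : ℤ)).hom.app (shObj s A') ≫
          (etaInvInf s A' ≫ e₁)⟦(1 : ℤ)⟧' = (etaInvInf s X' ≫ e₃) ≫ c := by
      rw [Functor.map_comp, Category.assoc, reassoc_of% limitFunctor_map_shTr s A',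
        ← Functor.map_comp, ← Category.assoc (etaInf s A'), etaInf_etaInvInf, Category.id_comp,
        reassoc_of% limitFunctor_map_shMap s w, c₃, Category.assoc]
    exact h

/-- The exact triangle of C₀ inside a strict exact triangle is the model, and φ gives the comparison
at the third vertex. -/
theorem hasModel_of_mem_unstableWeights {A B X : Level0 k C} {t : ℝ}
    {a : (limitFunctor k C).obj A ⟶ (limitFunctor k C).obj B}
    {b : (limitFunctor k C).obj B ⟶ (limitFunctor k C).obj X}
    {c : (limitFunctor k C).obj X ⟶ ((limitFunctor k C).obj A)⟦(1 : ℤ)⟧} {r : ℝ}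
    (h : r ∈ unstableWeights (etaInvInf t A ≫ a) b (c ≫ (etaInf t A)⟦(1 : ℤ)⟧')) :
    ∃ (hr : 0 ≤ r) (q s : ℝ), 0 ≤ q ∧ q ≤ s ∧ s ≤ r ∧ HasModel r hr t (-q) (-s) a b c := by
  obtain ⟨hr, q, s, hq, hqs, hsr, u', v', w', ⟨X', v'', w'', φ, ψ, hΔ, hφ, hψφ, hv, hw⟩,
    h₁, h₂, h₃⟩ := h
  refine ⟨hr, q, s, hq, hqs, hsr, _, _, _, _, _, _, etaInvInf t A, etaInvInf (-q) B,
    (limitFunctor k C).map φ ≫ etaInvInf (-s) X, hΔ, .etaInvInf t A, .etaInvInf (-q) B,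
    ⟨_, φ, _, hφ, .etaInvInf (-s) X, rfl⟩, h₁, ?_, ?_⟩
  · rw [← h₂, ← Category.assoc (etaInvInf (-q) B), etaInvInf_etaInf, Category.id_comp, ← hv,
      Functor.map_comp, Category.assoc]
  · have := hφ.isIso_map
    have hψ : (limitFunctor k C).map ψ ≫ (limitFunctor k C).map φ = etaInvInf r (shObj (-s) X) := by
      rw [← Functor.map_comp, hψφ, limitFunctor_map_etaZero]
    have : IsIso ((limitFunctor k C).map ψ ≫ (limitFunctor k C).map φ) := by
      rw [hψ]; infer_instance
    -- The condition on the third map is known only after precomposition with ψ; as the image of ψ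
    -- is invertible, it can be cancelled.
    have : IsIso ((limitFunctor k C).map ψ) := IsIso.of_isIso_comp_right _ ((limitFunctor k C).map φ)
    have hc : c = etaInf (-s) X ≫ (limitFunctor k C).map w' ≫ etaInvInf (-r) _ ≫
        ((limitFunctor k C).commShiftIso (1 : ℤ)).hom.app (shObj t A) ≫
          (etaInvInf t A)⟦(1 : ℤ)⟧' := by
      have : IsIso (etaInf t A) := ⟨etaInvInf t A, etaInf_etaInvInf t A, etaInvInf_etaInf t A⟩
      rw [← cancel_mono ((etaInf t A)⟦(1 : ℤ)⟧'), ← h₃]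
      simp only [Category.assoc, ← Functor.map_comp, etaInvInf_etaInf]
      simp
    rw [← cancel_epi ((limitFunctor k C).map ψ), hc, Category.assoc, reassoc_of% hψ,
      ← Category.assoc (etaInvInf (-s) X), etaInvInf_etaInf, Category.id_comp, ← Category.assoc,
      ← Functor.map_comp, hw, Functor.map_comp, limitFunctor_map_shCancel]
    simp only [Category.assoc]
    rw [reassoc_of% limitFunctor_map_shMap r w']

/-- The remaining data of a strict exact triangle always exist: φ has a section ψ up to η_r, and
every morphism out of Σ^r of an object is of the form Σ^r w' up to the canonical identification. -/
theorem HasModel.mem_unstableWeights {A B X : Level0 k C} {t : ℝ}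
    {a : (limitFunctor k C).obj A ⟶ (limitFunctor k C).obj B}
    {b : (limitFunctor k C).obj B ⟶ (limitFunctor k C).obj X}
    {c : (limitFunctor k C).obj X ⟶ ((limitFunctor k C).obj A)⟦(1 : ℤ)⟧} {r : ℝ} {hr : 0 ≤ r}
    {q s : ℝ} (hq : 0 ≤ q) (hqs : q ≤ s) (hsr : s ≤ r)
    (h : HasModel r hr t (-q) (-s) a b c) :
    r ∈ unstableWeights (etaInvInf t A ≫ a) b (c ≫ (etaInf t A)⟦(1 : ℤ)⟧') := by
  obtain ⟨A', B', X', u, v, w, e₁, e₂, e₃, hΔ, h₁, h₂, h₃, c₁, c₂, c₃⟩ := h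
  obtain ⟨i₁, rfl⟩ := h₁.exists_iso_shObj
  obtain ⟨i₂, rfl⟩ := h₂.exists_iso_shObj
  obtain ⟨φ, hφ, rfl⟩ := h₃.exists_shObj
  obtain ⟨ψ, hψ⟩ := hφ.exists_section
  obtain ⟨w', hw'⟩ := exists_shMap_shCancel r (ψ ≫ w ≫ i₁.hom⟦(1 : ℤ)⟧')
  refine ⟨hr, q, s, hq, hqs, hsr, i₁.inv ≫ u ≫ i₂.hom, i₂.inv ≫ v ≫ φ, w',
    ⟨X', i₂.inv ≫ v, w ≫ i₁.hom⟦(1 : ℤ)⟧', φ, ψ, ?_, hφ, hψ, by simp, hw'.symm⟩, ?_, ?_, ?_⟩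
  · exact distTriang_of_iso hΔ i₁.symm i₂.symm (Iso.refl _) (by simp) (by simp)
      (by simp [← Functor.map_comp])
  · simp only [Functor.map_comp, Category.assoc]
    rw [c₁, Category.assoc, Iso.map_inv_hom_id_assoc]
  · simp only [Functor.map_comp, Category.assoc]
    rw [c₂, Category.assoc, Iso.map_inv_hom_id_assoc, ← Category.assoc, etaInf_etaInvInf,
      Category.id_comp]
  · have hψ' : (limitFunctor k C).map ψ ≫ (limitFunctor k C).map φ =
        etaInvInf r (shObj (-s) X) := by
      rw [← Functor.map_comp, hψ, limitFunctor_map_etaZero]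
    -- The identity for the third map is tested after the isomorphism η_{r,0} followed by η_{-s,0},
    -- which brings Σ^r w', and with it ψ, into play.
    rw [← cancel_epi (etaInvInf r (shObj (-s) X) ≫ etaInvInf (-s) X), Category.assoc,
      ← Category.assoc (etaInvInf (-s) X), etaInvInf_etaInf, Category.id_comp,
      ← reassoc_of% limitFunctor_map_shMap r w',
      ← reassoc_of% limitFunctor_map_shCancel r ((shObj t A)⟦(1 : ℤ)⟧)]
    rw [← Functor.map_comp_assoc, hw', ← hψ', Category.assoc, ← Category.assoc (etaInvInf (-s) X)]
    simp only [Functor.map_comp, Category.assoc, commShiftIso_hom_app_naturality]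
    have := (limitFunctor k C).map ψ ≫= c₃ =≫ (etaInf t A)⟦(1 : ℤ)⟧'
    simp only [Functor.map_comp, Category.assoc] at this
    rw [← this, ← Functor.map_comp, etaInvInf_etaInf]
    simp

end Model

/-! ## The weighted octahedral axiom -/

section Octahedral

variable {k : Type w} [Field k] {C : Type u} [PersistenceCategory.{w, v, u} k C]
  [ShiftFunctor k C] [HasZeroObject (Level0 k C)] [HasShift (Level0 k C) ℤ]
  [∀ n : ℤ, (shiftFunctor (Level0 k C) n).Additive] [Pretriangulated (Level0 k C)]

/-- The octahedral axiom in `C₀`, for exact triangles which match up to an `r`-isomorphism. -/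
theorem exists_octahedron_of_isRIso [PersistenceTranslation k C] [IsTriangulated (Level0 k C)]
    {r : ℝ} {hr : 0 ≤ r}
    {A B X X' Y E F : Level0 k C} {u : A ⟶ B} {v : B ⟶ X} {w : X ⟶ A⟦(1 : ℤ)⟧}
    (h₁ : Triangle.mk u v w ∈ distTriang (Level0 k C)) {φ : X ⟶ X'} (hφ : IsRIso r hr φ)
    {d : X' ⟶ Y} {e : Y ⟶ E} {f : E ⟶ X'⟦(1 : ℤ)⟧}
    (h₂ : Triangle.mk d e f ∈ distTriang (Level0 k C))
    {g : Y ⟶ F} {h : F ⟶ B⟦(1 : ℤ)⟧}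
    (h₃ : Triangle.mk (v ≫ φ ≫ d) g h ∈ distTriang (Level0 k C)) :
    ∃ (E' : Level0 k C) (x : A⟦(1 : ℤ)⟧ ⟶ F) (y : F ⟶ E') (z : E' ⟶ A⟦(1 : ℤ)⟧⟦(1 : ℤ)⟧)
      (θ : E' ⟶ E) (ω : E' ⟶ X⟦(1 : ℤ)⟧),
      Triangle.mk x y z ∈ distTriang (Level0 k C) ∧ IsRIso r hr θ ∧
        w ≫ x = -(φ ≫ d ≫ g) ∧ x ≫ h = u⟦(1 : ℤ)⟧' ∧ g ≫ y ≫ θ = e ∧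
        y ≫ ω = h ≫ v⟦(1 : ℤ)⟧' ∧ θ ≫ f = ω ≫ φ⟦(1 : ℤ)⟧' ∧ z = -(ω ≫ w⟦(1 : ℤ)⟧') := by
  obtain ⟨E', e', ω, hω⟩ := distinguished_cocone_triangle (φ ≫ d)
  obtain ⟨K, p, q, hK, hK'⟩ := hφ
  -- Octahedron of v followed by φ ≫ d; the rotated triangle exhibits TA as the cone of v.
  have O := Triangulated.someOctahedron (Category.assoc v φ d ▸ rfl : v ≫ φ ≫ d = v ≫ φ ≫ d)
    (distTriang_rot h₁) hω h₃
  -- Octahedron of φ followed by d; it gives θ : E' ⟶ E the cone K[1], which is r-acyclic.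
  have O' := Triangulated.someOctahedron rfl hK h₂ hω
  refine ⟨E', -O.m₁, O.m₃, -(ω ≫ w⟦(1 : ℤ)⟧'), O'.m₃, ω, ?_,
    ⟨_, _, _, distTriang_rot O'.mem, hK'.shift 1⟩, ?_, ?_, ?_, O.comm₄.symm, O'.comm₄.symm, rfl⟩
  -- The rotation makes `O.m₁` followed by h equal to -Tu. Changing the sign on TA corrects this,
  -- and puts into z the sign responsible for the anti-commuting square.
  · exact distTriang_of_iso O.mem ⟨-𝟙 _, -𝟙 _, by simp, by simp⟩ (Iso.refl _) (Iso.refl _)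
      (by simp) (by simp) (by simp)
  · simpa using congrArg (-·) O.comm₁
  · have := O.comm₂
    rw [Preadditive.neg_comp, this, neg_neg]
  · rw [reassoc_of% O.comm₃, O'.comm₃]

variable [PersistenceTranslation k C] [TriangulatedPersistenceCategory k C]

theorem HasModel.distTriang {r : ℝ} {hr : 0 ≤ r} {x y z : ℝ} {A B X : LevelInf k C} {a : A ⟶ B}
    {b : B ⟶ X} {c : X ⟶ A⟦(1 : ℤ)⟧} (h : HasModel r hr x y z a b c) :
    Triangle.mk a b c ∈ distTriang (LevelInf k C) := by
  obtain ⟨A', B', X', u, v, w, e₁, e₂, e₃, hΔ, h₁, h₂, h₃, c₁, c₂, c₃⟩ := h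
  have := h₁.isIso
  have := h₂.isIso
  have := h₃.isIso
  have hL : Triangle.mk ((limitFunctor k C).map u) ((limitFunctor k C).map v)
      ((limitFunctor k C).map w ≫ ((limitFunctor k C).commShiftIso (1 : ℤ)).hom.app A') ∈
        distTriang (LevelInf k C) := (limitFunctor k C).map_distinguished _ hΔ
  refine distTriang_of_iso hL (asIso e₁).symm (asIso e₂).symm (asIso e₃).symm ?_ ?_ ?_
  · simp [c₁, ← cancel_epi e₁, ← cancel_mono e₂]
  · simp [c₂, ← cancel_epi e₂, ← cancel_mono e₃]
  · rw [← cancel_epi e₃, ← cancel_mono (e₁⟦(1 : ℤ)⟧')]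
    simp [← c₃, ← Functor.map_comp]

/-- Transports the octahedron of C₀ along the comparison maps. The completion g, h is given from
outside, so that it can be chosen freely later. The relation on `c ≫ x` is not part of the diagram;
it determines x when c is invertible. -/
theorem exists_octahedralDiagram_of_models {r r' : ℝ} {hr : 0 ≤ r} {hr' : 0 ≤ r'}
    {α β β' γ' : ℝ} {A B X Y E F : LevelInf k C}
    {a : A ⟶ B} {b : B ⟶ X} {c : X ⟶ A⟦(1 : ℤ)⟧}
    {d : X ⟶ Y} {e : Y ⟶ E} {f : E ⟶ X⟦(1 : ℤ)⟧}
    {A' B' X' X'' Y' E' F' : Level0 k C} {u : A' ⟶ B'} {v : B' ⟶ X'} {w : X' ⟶ A'⟦(1 : ℤ)⟧}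
    {φ : X' ⟶ X''} {u₂ : X'' ⟶ Y'} {v₂ : Y' ⟶ E'} {w₂ : E' ⟶ X''⟦(1 : ℤ)⟧}
    {e₁ : (limitFunctor k C).obj A' ⟶ A} {e₂ : (limitFunctor k C).obj B' ⟶ B}
    {f₁ : (limitFunctor k C).obj X'' ⟶ X} {f₂ : (limitFunctor k C).obj Y' ⟶ Y}
    {f₃ : (limitFunctor k C).obj E' ⟶ E} {eF : (limitFunctor k C).obj F' ⟶ F}
    (hΔ₁ : Triangle.mk u v w ∈ distTriang (Level0 k C))
    (hΔ₂ : Triangle.mk u₂ v₂ w₂ ∈ distTriang (Level0 k C))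
    (h₁ : IsShiftIso α e₁) (h₂ : IsShiftIso β e₂) (hφ : IsRIso r hr φ) (hf₁ : IsIso f₁)
    (h₂' : IsShiftIso β' f₂) (h₃' : IsShiftRIso r' hr' γ' f₃)
    (c₁ : (limitFunctor k C).map u ≫ e₂ = e₁ ≫ a)
    (c₂ : (limitFunctor k C).map v ≫ (limitFunctor k C).map φ ≫ f₁ = e₂ ≫ b)
    (c₃ : (limitFunctor k C).map w ≫ ((limitFunctor k C).commShiftIso (1 : ℤ)).hom.app A' ≫
      e₁⟦(1 : ℤ)⟧' = (limitFunctor k C).map φ ≫ f₁ ≫ c)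
    (c₁' : (limitFunctor k C).map u₂ ≫ f₂ = f₁ ≫ d)
    (c₂' : (limitFunctor k C).map v₂ ≫ f₃ = f₂ ≫ e)
    (c₃' : (limitFunctor k C).map w₂ ≫ ((limitFunctor k C).commShiftIso (1 : ℤ)).hom.app X'' ≫
      f₁⟦(1 : ℤ)⟧' = f₃ ≫ f)
    {g' : Y' ⟶ F'} {h' : F' ⟶ B'⟦(1 : ℤ)⟧}
    (h₃ : Triangle.mk (v ≫ φ ≫ u₂) g' h' ∈ distTriang (Level0 k C)) (hF : IsShiftIso 0 eF)
    {g : Y ⟶ F} {h : F ⟶ B⟦(1 : ℤ)⟧} (hg : (limitFunctor k C).map g' ≫ eF = f₂ ≫ g)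
    (hh : (limitFunctor k C).map h' ≫ ((limitFunctor k C).commShiftIso (1 : ℤ)).hom.app B' ≫
      e₂⟦(1 : ℤ)⟧' = eF ≫ h) :
    ∃ (x : A⟦(1 : ℤ)⟧ ⟶ F) (y : F ⟶ E) (z : E ⟶ A⟦(1 : ℤ)⟧⟦(1 : ℤ)⟧),
      OctahedralDiagram a b c d e f (b ≫ d) g h x y z ∧
      HasModel 0 le_rfl β β' 0 (b ≫ d) g h ∧
      HasModel (r + r') (add_nonneg hr hr') α 0 γ' x y z ∧ c ≫ x = -(d ≫ g) := by
  have := h₁.isIso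
  have := h₂.isIso
  have := h₂'.isIso
  have := h₃'.isIso
  have := hF.isIso
  have := hφ.isIso_map
  obtain ⟨E'', x', y', z', θ, ω, hΔ₄, hθ, hwx, hxh, hgy, hyω, hθf, rfl⟩ :=
    exists_octahedron_of_isRIso hΔ₁ hφ hΔ₂ h₃
  have hκ : IsShiftIso α (((limitFunctor k C).commShiftIso (1 : ℤ)).hom.app A' ≫ e₁⟦(1 : ℤ)⟧') :=
    ((isShiftIso_commShiftIso_hom_app 1 A').comp (h₁.shift 1)).congr_shift (zero_add α)
  have := hθ.isIso_map
  obtain ⟨x, hx⟩ : ∃ x : A⟦(1 : ℤ)⟧ ⟶ F, ((limitFunctor k C).commShiftIso (1 : ℤ)).hom.app A' ≫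
      e₁⟦(1 : ℤ)⟧' ≫ x = (limitFunctor k C).map x' ≫ eF :=
    ⟨inv (e₁⟦(1 : ℤ)⟧') ≫ ((limitFunctor k C).commShiftIso (1 : ℤ)).inv.app A' ≫
      (limitFunctor k C).map x' ≫ eF, by simp⟩
  obtain ⟨y, hy⟩ : ∃ y : F ⟶ E, eF ≫ y =
      (limitFunctor k C).map y' ≫ (limitFunctor k C).map θ ≫ f₃ :=
    ⟨inv eF ≫ (limitFunctor k C).map y' ≫ (limitFunctor k C).map θ ≫ f₃, by simp⟩
  have hab : a ≫ b = 0 := by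
    rw [← cancel_epi e₁, ← reassoc_of% c₁, ← c₂, ← Functor.map_comp_assoc,
      show u ≫ v = 0 from comp_distTriang_mor_zero₁₂ _ hΔ₁]
    simp
  have hef : e ≫ f = 0 := by
    rw [← cancel_epi f₂, ← reassoc_of% c₂', ← c₃', ← Functor.map_comp_assoc,
      show v₂ ≫ w₂ = 0 from comp_distTriang_mor_zero₂₃ _ hΔ₂]
    simp
  have hff : (limitFunctor k C).map θ ≫ f₃ ≫ f = (limitFunctor k C).map ω ≫
      ((limitFunctor k C).commShiftIso (1 : ℤ)).hom.app X' ≫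
        ((limitFunctor k C).map φ ≫ f₁)⟦(1 : ℤ)⟧' := by
    rw [← c₃', ← Functor.map_comp_assoc, hθf, Functor.map_comp, Category.assoc,
      reassoc_of% commShiftIso_hom_app_naturality φ, Functor.map_comp]
  -- The third map is forced by the anti-commuting square; x and y are forced by compatibility with
  -- the model.
  refine ⟨x, y, -(f ≫ c⟦(1 : ℤ)⟧'), ⟨?_, ?_, rfl, ?_, ?_, ?_, by simp⟩, ?_, ?_, ?_⟩
  · rw [reassoc_of% hab, zero_comp]
  · rw [← cancel_epi (e₁⟦(1 : ℤ)⟧'),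
      ← cancel_epi (((limitFunctor k C).commShiftIso (1 : ℤ)).hom.app A'), reassoc_of% hx, ← hh,
      ← Functor.map_comp_assoc, hxh, reassoc_of% commShiftIso_hom_app_naturality u,
      ← Functor.map_comp, c₁, Functor.map_comp]
  · rw [← cancel_epi f₂, ← reassoc_of% hg, hy, ← c₂', ← hgy]
    simp
  · rw [← cancel_epi eF, reassoc_of% hy, hff, ← Functor.map_comp_assoc, hyω, ← reassoc_of% hh,
      Functor.map_comp, Category.assoc, reassoc_of% commShiftIso_hom_app_naturality v,
      ← Functor.map_comp, c₂, Functor.map_comp]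
  · rw [Preadditive.comp_neg, reassoc_of% hef, zero_comp, neg_zero]
  · refine ⟨_, _, _, _, _, _, e₂, f₂, eF, h₃, h₂, h₂', hF.isShiftRIso, ?_, hg, hh⟩
    rw [Functor.map_comp, Functor.map_comp, Category.assoc, Category.assoc, c₁', reassoc_of% c₂]
  · refine ⟨_, _, _, _, _, _, _, eF, (limitFunctor k C).map θ ≫ f₃, hΔ₄, hκ, hF,
      IsShiftRIso.map_comp hθ h₃', ?_, ?_, ?_⟩
    · rw [← hx, Category.assoc]
    · rw [hy]
    · rw [Preadditive.comp_neg, Category.assoc, reassoc_of% hff, Functor.map_neg,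
        Preadditive.neg_comp, Functor.map_comp, Category.assoc,
        reassoc_of% commShiftIso_hom_app_naturality w, ← Functor.map_comp, ← Functor.map_comp]
      rw [c₃, Category.assoc]
  · rw [← cancel_epi f₁, ← cancel_epi ((limitFunctor k C).map φ), ← reassoc_of% c₃, hx,
      ← Functor.map_comp_assoc, hwx, Preadditive.comp_neg, Preadditive.comp_neg, ← reassoc_of% c₁',
      ← hg]
    simp

end Octahedral

/-! ## Weights of triangles of the limit category -/

section Weight

variable {k : Type w} [Field k] {C : Type u} [PersistenceCategory.{w, v, u} k C]
  [ShiftFunctor k C] [HasZeroObject (Level0 k C)] [HasShift (Level0 k C) ℤ]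
  [∀ n : ℤ, (shiftFunctor (Level0 k C) n).Additive] [Pretriangulated (Level0 k C)]
  [PersistenceTranslation k C]

/-- `r` is the weight of a strict exact triangle which represents the triangle `(a, b, c)`, after
shifting its first object. -/
def HasWeight (r : ℝ) {A B X : LevelInf k C} (a : A ⟶ B) (b : B ⟶ X) (c : X ⟶ A⟦(1 : ℤ)⟧) : Prop :=
  ∃ (hr : 0 ≤ r) (x z : ℝ), 0 ≤ x ∧ z ≤ 0 ∧ -r ≤ z ∧ HasModel r hr x 0 z a b c

variable [TriangulatedPersistenceCategory k C]

theorem HasModel.hasWeight {r : ℝ} {hr : 0 ≤ r} {x y z : ℝ} {A B X : LevelInf k C} {a : A ⟶ B}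
    {b : B ⟶ X} {c : X ⟶ A⟦(1 : ℤ)⟧} (h : HasModel r hr x y z a b c) (hxy : y ≤ x) (hyz : z ≤ y)
    (hzr : y - r ≤ z) : HasWeight r a b c := by
  have := h.shift (-y)
  rw [neg_add_cancel] at this
  exact ⟨hr, _, _, by linarith, by linarith, by linarith, this⟩

/-- Because t ranges over all nonnegative reals, q is superfluous: shifting the model by q replaces
t, q, s by t + q, 0, s - q. -/
theorem exists_mem_shiftedWeights_iff {Δ : Triangle (LevelInf k C)} {r : ℝ} :
    (∃ t : ℝ, 0 ≤ t ∧ r ∈ shiftedWeights t Δ) ↔ HasWeight r Δ.mor₁ Δ.mor₂ Δ.mor₃ := by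
  constructor
  · rintro ⟨t, ht, h⟩
    obtain ⟨hr, q, s, hq, hqs, hsr, h'⟩ := hasModel_of_mem_unstableWeights
      (A := Δ.obj₁.toLevel0) (B := Δ.obj₂.toLevel0) (X := Δ.obj₃.toLevel0) h
    exact h'.hasWeight (by linarith) (by linarith) (by linarith)
  · rintro ⟨hr, x, z, hx, hz, hrz, h⟩
    refine ⟨x, hx, HasModel.mem_unstableWeights (A := Δ.obj₁.toLevel0) (B := Δ.obj₂.toLevel0)
      (X := Δ.obj₃.toLevel0) (q := 0) (s := -z) (hr := hr) le_rfl (by linarith) (by linarith) ?_⟩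
    rw [neg_zero, neg_neg]
    exact h

theorem HasWeight.persistenceWeight_le {r : ℝ} {A B X : LevelInf k C} {a : A ⟶ B} {b : B ⟶ X}
    {c : X ⟶ A⟦(1 : ℤ)⟧} (h : HasWeight r a b c) :
    persistenceWeight (Triangle.mk a b c) ≤ ENNReal.ofReal r := by
  obtain ⟨t, ht, h⟩ := exists_mem_shiftedWeights_iff (Δ := Triangle.mk a b c).2 h
  exact (iInf₂_le t ht).trans (iInf₂_le r h)

theorem le_persistenceWeight {A B X : LevelInf k C} {a : A ⟶ B} {b : B ⟶ X}
    {c : X ⟶ A⟦(1 : ℤ)⟧} {m : ℝ≥0∞} (h : ∀ r, HasWeight r a b c → m ≤ ENNReal.ofReal r) :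
    m ≤ persistenceWeight (Triangle.mk a b c) :=
  le_iInf₂ fun t ht => le_iInf₂ fun r hr =>
    h r ((exists_mem_shiftedWeights_iff (Δ := Triangle.mk a b c)).1 ⟨t, ht, hr⟩)

theorem WeightIsAttained.exists_hasWeight {A B X : LevelInf k C} {a : A ⟶ B} {b : B ⟶ X}
    {c : X ⟶ A⟦(1 : ℤ)⟧} (h : WeightIsAttained (Triangle.mk a b c)) :
    ∃ r, HasWeight r a b c ∧ ENNReal.ofReal r = persistenceWeight (Triangle.mk a b c) := by
  obtain ⟨t, ht, r, hr, h⟩ := h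
  exact ⟨r, (exists_mem_shiftedWeights_iff (Δ := Triangle.mk a b c)).1 ⟨t, ht, hr⟩, h⟩

theorem exists_hasWeight_lt {A B X : LevelInf k C} {a : A ⟶ B} {b : B ⟶ X}
    {c : X ⟶ A⟦(1 : ℤ)⟧} {m : ℝ≥0∞} (h : persistenceWeight (Triangle.mk a b c) < m) :
    ∃ r, HasWeight r a b c ∧ ENNReal.ofReal r < m := by
  by_contra! H
  exact absurd (le_persistenceWeight H) (not_le.2 h)

theorem isAcyclic_of_isZero_limit {K : Level0 k C} (h : IsZero ((limitFunctor k C).obj K)) :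
    acyclics k C K := by
  have h' : toInf (ident (k := k) K.as) = toInf (0 : Hom k 0 K.as K.as) :=
    (h.eq_of_src (𝟙 _) 0).trans ((limitFunctor k C).map_zero K K).symm
  obtain ⟨r, hr, e⟩ := (toInf_eq_toInf_iff _ _).1 h'
  rw [map_zero] at e
  exact ⟨r, hr, e⟩

/-- The cone of f becomes zero in C_∞, so its identity vanishes already at a finite level. -/
theorem exists_isRIso_of_isIso_map {A B : Level0 k C} (f : A ⟶ B)
    (hf : IsIso ((limitFunctor k C).map f)) : ∃ (r : ℝ) (hr : 0 ≤ r), IsRIso r hr f := by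
  obtain ⟨K, v, w, h⟩ := distinguished_cocone_triangle f
  have h' := (limitFunctor k C).map_distinguished _ h
  obtain ⟨r, hr, hK⟩ := isAcyclic_of_isZero_limit (Triangle.isZero₃_of_isIso₁ _ h' hf)
  exact ⟨r, hr, K, v, w, h, hK⟩

theorem exists_limitFunctor_map_target {A B : Level0 k C}
    (φ : (limitFunctor k C).obj A ⟶ (limitFunctor k C).obj B) :
    ∃ (r : ℝ) (_ : 0 ≤ r) (f : A ⟶ shObj (-r) B),
      φ = (limitFunctor k C).map f ≫ etaInvInf (-r) B := by
  obtain ⟨r, hr, h, rfl⟩ := exists_toInf φ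
  change Hom k r A.as B.as at h
  refine ⟨r, hr, toZero (incl (add_neg_cancel r).le (comp h (ShiftFunctor.eta (-r) B.as))), ?_⟩
  have e : (limitFunctor k C).map (X := A) (Y := shObj (-r) B)
      (toZero (incl (add_neg_cancel r).le (comp h (ShiftFunctor.eta (-r) B.as)))) =
        toInf h ≫ etaInf (-r) B := (toInf_incl _ _).trans (toInf_comp _ _)
  rw [e]
  exact ((Category.assoc _ _ _).trans ((congrArg (toInf (A := A.as) (B := B.as) h ≫ ·)
    (etaInf_etaInvInf (-r) B)).trans (Category.comp_id _))).symm

/-- After shifting its source, a lies in C₀ and is completed there to an exact triangle. The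
comparison of cones in C_∞ lies in C₀ after shifting its target by -s, and there it is an
r-isomorphism for some r. -/
theorem exists_hasWeight_of_level0 {A B X : Level0 k C}
    {a : (limitFunctor k C).obj A ⟶ (limitFunctor k C).obj B}
    {b : (limitFunctor k C).obj B ⟶ (limitFunctor k C).obj X}
    {c : (limitFunctor k C).obj X ⟶ ((limitFunctor k C).obj A)⟦(1 : ℤ)⟧}
    (h : Triangle.mk a b c ∈ distTriang (LevelInf k C)) : ∃ r, HasWeight r a b c := by
  obtain ⟨t, ht, f, hf⟩ := exists_limitFunctor_map a
  obtain ⟨X', v, w, hΔ⟩ := distinguished_cocone_triangle f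
  have hL : Triangle.mk ((limitFunctor k C).map f) ((limitFunctor k C).map v)
      ((limitFunctor k C).map w ≫ ((limitFunctor k C).commShiftIso (1 : ℤ)).hom.app _) ∈
        distTriang (LevelInf k C) := (limitFunctor k C).map_distinguished _ hΔ
  have ha : (limitFunctor k C).map f = etaInvInf t A ≫ a := by
    rw [hf, ← Category.assoc, etaInvInf_etaInf, Category.id_comp]
  obtain ⟨e₃, h₂, h₃⟩ := exists_iso_cone hL h (asIso (etaInvInf t A)) (Iso.refl _)
    ((Category.comp_id _).trans ha)
  obtain ⟨s, hs, φ, hφ⟩ := exists_limitFunctor_map_target (B := X) e₃.hom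
  have hφ' : (limitFunctor k C).map φ = e₃.hom ≫ etaInf (-s) X := by
    rw [hφ, Category.assoc, etaInvInf_etaInf, Category.comp_id]
  have : IsIso (etaInf (-s) X) :=
    ⟨etaInvInf _ _, etaInf_etaInvInf _ _, etaInvInf_etaInf _ _⟩
  obtain ⟨r, hr, hr'⟩ := exists_isRIso_of_isIso_map φ (by rw [hφ']; infer_instance)
  -- The weight has to dominate both the level of acyclicity r and the shift s.
  have hs' : IsShiftRIso (max r s) (le_max_of_le_left hr) (-s) e₃.hom :=
    ⟨_, φ, _, hr'.mono (le_max_left _ _), .etaInvInf (-s) X, hφ⟩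
  refine ⟨max r s, le_max_of_le_left hr, t, -s, ht, by linarith, neg_le_neg (le_max_right _ _),
    _, _, _, _, _, _, etaInvInf t A, 𝟙 _, e₃.hom, hΔ, .etaInvInf t _, .id _, hs',
    (Category.comp_id _).trans ha, h₂, ?_⟩
  rw [← h₃, Category.assoc]
  rfl

/-- Every exact triangle of `C_∞` is represented by a strict exact triangle. -/
theorem exists_hasWeight {A B X : LevelInf k C} {a : A ⟶ B} {b : B ⟶ X}
    {c : X ⟶ A⟦(1 : ℤ)⟧} (h : Triangle.mk a b c ∈ distTriang (LevelInf k C)) :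
    ∃ r, HasWeight r a b c :=
  exists_hasWeight_of_level0 (A := A.toLevel0) (B := B.toLevel0) (X := X.toLevel0) h

end Weight

/-! ### Octahedra for given weights, passage to the infimum, and the case B = 0. -/

section WeightedOctahedron

variable {k : Type w} [Field k] {C : Type u} [PersistenceCategory.{w, v, u} k C]
  [ShiftFunctor k C] [HasZeroObject (Level0 k C)] [HasShift (Level0 k C) ℤ]
  [∀ n : ℤ, (shiftFunctor (Level0 k C) n).Additive] [Pretriangulated (Level0 k C)]
  [PersistenceTranslation k C] [TriangulatedPersistenceCategory k C]

theorem HasWeight.distTriang {r : ℝ} {A B X : LevelInf k C} {a : A ⟶ B} {b : B ⟶ X}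
    {c : X ⟶ A⟦(1 : ℤ)⟧} (h : HasWeight r a b c) :
    Triangle.mk a b c ∈ distTriang (LevelInf k C) := by
  obtain ⟨_, _, _, _, _, _, h⟩ := h
  exact h.distTriang

/-- The octahedral axiom for triangles of given weights: every completion of a model of the
composition `B ⟶ X ⟶ Y` to an exact triangle of `C₀` gives rise to an octahedron. -/
theorem exists_octahedralDiagram_of_hasWeight {r r' : ℝ} {A B X Y E : LevelInf k C}
    {a : A ⟶ B} {b : B ⟶ X} {c : X ⟶ A⟦(1 : ℤ)⟧} {d : X ⟶ Y} {e : Y ⟶ E} {f : E ⟶ X⟦(1 : ℤ)⟧}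
    (h₁ : HasWeight r a b c) (h₂ : HasWeight r' d e f) :
    ∃ (B' Y' : Level0 k C) (p : B' ⟶ Y') (β : ℝ) (e₂ : (limitFunctor k C).obj B' ⟶ B)
      (f₂ : (limitFunctor k C).obj Y' ⟶ Y), IsShiftIso β e₂ ∧ IsShiftIso 0 f₂ ∧
      ∀ (F' : Level0 k C) (g' : Y' ⟶ F') (h' : F' ⟶ B'⟦(1 : ℤ)⟧) (F : LevelInf k C)
        (eF : (limitFunctor k C).obj F' ⟶ F) (g : Y ⟶ F) (h : F ⟶ B⟦(1 : ℤ)⟧),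
        Triangle.mk p g' h' ∈ distTriang (Level0 k C) → IsShiftIso 0 eF →
        (limitFunctor k C).map g' ≫ eF = f₂ ≫ g →
        (limitFunctor k C).map h' ≫ ((limitFunctor k C).commShiftIso (1 : ℤ)).hom.app B' ≫
          e₂⟦(1 : ℤ)⟧' = eF ≫ h →
        ∃ (x : A⟦(1 : ℤ)⟧ ⟶ F) (y : F ⟶ E) (z : E ⟶ A⟦(1 : ℤ)⟧⟦(1 : ℤ)⟧),
          OctahedralDiagram a b c d e f (b ≫ d) g h x y z ∧ HasWeight 0 (b ≫ d) g h ∧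
          HasWeight (r + r') x y z ∧ c ≫ x = -(d ≫ g) := by
  obtain ⟨hr, α, γ, hα, hγ, hrγ, h₁⟩ := h₁
  obtain ⟨hr', α', γ', hα', hγ', hrγ', h₂⟩ := h₂
  -- Shifting by α' - γ moves the third shift of the first model to α', the first shift of the
  -- second model.
  obtain ⟨A', B', X', u, v, w, e₁, e₂, e₃, hΔ₁, i₁, i₂, i₃, c₁, c₂, c₃⟩ := h₁.shift (α' - γ)
  obtain ⟨X'', Y', E', u₂, v₂, w₂, f₁, f₂, f₃, hΔ₂, j₁, j₂, j₃, c₁', c₂', c₃'⟩ := h₂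
  have := j₁.isIso
  -- The two models of X now differ by an r-isomorphism of shift 0, hence by one of C₀.
  obtain ⟨φ, hφ, hφ'⟩ := ((i₃.comp_isShiftIso j₁.inv).congr_shift (by ring)).exists_map
  have h₃ : e₃ = (limitFunctor k C).map φ ≫ f₁ := by rw [← hφ']; simp
  subst h₃
  refine ⟨B', Y', v ≫ φ ≫ u₂, _, e₂, f₂, i₂, j₂, fun F' g' h' F eF g h hF heF hg hh => ?_⟩
  rw [Category.assoc] at c₃
  obtain ⟨x, y, z, hO, hM, hM', hc⟩ := exists_octahedralDiagram_of_models hΔ₁ hΔ₂ i₁ i₂ hφ j₁.isIso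
    j₂ j₃ c₁ c₂ c₃ c₁' c₂' c₃' hF heF hg hh
  -- Weight 0 for the first triangle requires α' - γ ≥ 0, which holds since α' ≥ 0 and γ ≤ 0.
  exact ⟨x, y, z, hO, hM.hasWeight (by linarith) le_rfl (by linarith),
    hM'.hasWeight (by linarith) hγ' (by linarith), hc⟩

theorem hasWeightedOctahedron_of_hasWeight {r r' : ℝ} {A B X Y E : LevelInf k C}
    {a : A ⟶ B} {b : B ⟶ X} {c : X ⟶ A⟦(1 : ℤ)⟧} {d : X ⟶ Y} {e : Y ⟶ E} {f : E ⟶ X⟦(1 : ℤ)⟧}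
    (h₁ : HasWeight r a b c) (h₂ : HasWeight r' d e f) {m : ℝ≥0∞}
    (hm : ENNReal.ofReal r + ENNReal.ofReal r' ≤ m) :
    HasWeightedOctahedron persistenceWeight a b c d e f m := by
  have hr := h₁.choose
  have hr' := h₂.choose
  obtain ⟨B', Y', p, β, e₂, f₂, i₂, j₂, H⟩ := exists_octahedralDiagram_of_hasWeight h₁ h₂
  obtain ⟨F', g', h', hF⟩ := distinguished_cocone_triangle p
  have := j₂.isIso
  obtain ⟨x, y, z, hO, hw, hw', -⟩ := H F' g' h' _ (𝟙 _) (inv f₂ ≫ (limitFunctor k C).map g')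
    ((limitFunctor k C).map h' ≫ ((limitFunctor k C).commShiftIso (1 : ℤ)).hom.app B' ≫
      e₂⟦(1 : ℤ)⟧') hF (.id _) (by simp) (by simp)
  refine ⟨_, _, _, _, x, y, z, hw.distTriang, hw'.distTriang, hO,
    (add_le_add hw.persistenceWeight_le hw'.persistenceWeight_le).trans (le_trans ?_ hm)⟩
  rw [ENNReal.ofReal_zero, zero_add, ENNReal.ofReal_add hr hr']

theorem persistenceWeight_ne_top {A B X : LevelInf k C} {a : A ⟶ B} {b : B ⟶ X}
    {c : X ⟶ A⟦(1 : ℤ)⟧} (h : Triangle.mk a b c ∈ distTriang (LevelInf k C)) :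
    persistenceWeight (Triangle.mk a b c) ≠ ⊤ := by
  obtain ⟨r, hr⟩ := exists_hasWeight h
  exact ne_top_of_le_ne_top ENNReal.ofReal_ne_top hr.persistenceWeight_le

theorem hasWeightedOctahedron_add {A B X Y E : LevelInf k C}
    {a : A ⟶ B} {b : B ⟶ X} {c : X ⟶ A⟦(1 : ℤ)⟧} {d : X ⟶ Y} {e : Y ⟶ E} {f : E ⟶ X⟦(1 : ℤ)⟧}
    (h₁ : Triangle.mk a b c ∈ distTriang (LevelInf k C))
    (h₂ : Triangle.mk d e f ∈ distTriang (LevelInf k C)) {ε : ℝ≥0} (hε : 0 < ε) :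
    HasWeightedOctahedron persistenceWeight a b c d e f
      (persistenceWeight (Triangle.mk a b c) + persistenceWeight (Triangle.mk d e f) + ε) := by
  have hε' : ((ε / 2 : ℝ≥0) : ℝ≥0∞) ≠ 0 := by simpa using hε.ne'
  obtain ⟨r, hr, hr'⟩ := exists_hasWeight_lt
    (ENNReal.lt_add_right (persistenceWeight_ne_top h₁) hε')
  obtain ⟨s, hs, hs'⟩ := exists_hasWeight_lt
    (ENNReal.lt_add_right (persistenceWeight_ne_top h₂) hε')
  refine hasWeightedOctahedron_of_hasWeight hr hs ((add_le_add hr'.le hs'.le).trans ?_)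
  rw [add_add_add_comm, ← ENNReal.coe_add, add_halves]

theorem hasWeightedOctahedron_of_weightIsAttained {A B X Y E : LevelInf k C}
    {a : A ⟶ B} {b : B ⟶ X} {c : X ⟶ A⟦(1 : ℤ)⟧} {d : X ⟶ Y} {e : Y ⟶ E} {f : E ⟶ X⟦(1 : ℤ)⟧}
    (h₁ : WeightIsAttained (Triangle.mk a b c)) (h₂ : WeightIsAttained (Triangle.mk d e f)) :
    HasWeightedOctahedron persistenceWeight a b c d e f
      (persistenceWeight (Triangle.mk a b c) + persistenceWeight (Triangle.mk d e f)) := by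
  obtain ⟨r, hr, hr'⟩ := h₁.exists_hasWeight
  obtain ⟨s, hs, hs'⟩ := h₂.exists_hasWeight
  exact hasWeightedOctahedron_of_hasWeight hr hs (by rw [hr', hs'])

/-- Truncated subtraction allows the two infima to be taken one after the other without any ε. The
bounded triangle must not depend on r and r'. -/
theorem persistenceWeight_le_add {A B X A' B' X' A'' B'' X'' : LevelInf k C}
    {a : A ⟶ B} {b : B ⟶ X} {c : X ⟶ A⟦(1 : ℤ)⟧}
    {a' : A' ⟶ B'} {b' : B' ⟶ X'} {c' : X' ⟶ A'⟦(1 : ℤ)⟧}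
    {a'' : A'' ⟶ B''} {b'' : B'' ⟶ X''} {c'' : X'' ⟶ A''⟦(1 : ℤ)⟧}
    (h : ∀ r r', HasWeight r a b c → HasWeight r' a' b' c' → HasWeight (r + r') a'' b'' c'') :
    persistenceWeight (Triangle.mk a'' b'' c'') ≤
      persistenceWeight (Triangle.mk a b c) + persistenceWeight (Triangle.mk a' b' c') := by
  rw [← tsub_le_iff_left]
  refine le_persistenceWeight fun r' hr' => ?_
  rw [tsub_le_iff_left, ← tsub_le_iff_right]
  refine le_persistenceWeight fun r hr => ?_
  rw [tsub_le_iff_right, ← ENNReal.ofReal_add hr.choose hr'.choose]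
  exact (h r r' hr hr').persistenceWeight_le

/-- The octahedral axiom for an object `B` which is zero. -/
theorem exists_octahedralDiagram_of_isZero {Z : Level0 k C} (hZ : IsZero Z) {r r' : ℝ}
    {A X Y E : LevelInf k C} {a : A ⟶ (limitFunctor k C).obj Z}
    {b : (limitFunctor k C).obj Z ⟶ X} {c : X ⟶ A⟦(1 : ℤ)⟧} {d : X ⟶ Y} {e : Y ⟶ E}
    {f : E ⟶ X⟦(1 : ℤ)⟧} (h₁ : HasWeight r a b c) (h₂ : HasWeight r' d e f) :
    ∃ (x : A⟦(1 : ℤ)⟧ ⟶ Y) (y : Y ⟶ E) (z : E ⟶ A⟦(1 : ℤ)⟧⟦(1 : ℤ)⟧),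
      OctahedralDiagram a b c d e f (0 : (limitFunctor k C).obj Z ⟶ Y) (𝟙 Y) 0 x y z ∧
      HasWeight 0 (0 : (limitFunctor k C).obj Z ⟶ Y) (𝟙 Y) 0 ∧
      HasWeight (r + r') x y z ∧ c ≫ x = -d := by
  obtain ⟨B', Y', p, β, e₂, f₂, i₂, j₂, H⟩ := exists_octahedralDiagram_of_hasWeight h₁ h₂
  have hB' : IsZero B' := ((IsAcyclic.of_isZero hZ).of_isShiftIso i₂).isZero
  have hbd : b ≫ d = 0 := ((limitFunctor k C).map_isZero hZ).eq_of_src _ _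
  rw [hbd] at H
  -- As B' is zero, Y' itself is a cone of p.
  obtain ⟨x, y, z, hO, hw, hw', hx⟩ := H Y' (𝟙 Y') 0 Y f₂ (𝟙 Y) 0
    ((Triangle.distinguished_iff_of_isZero₁ _ hB').2 (inferInstanceAs (IsIso (𝟙 Y')))) j₂
    (by simp) (by simp)
  exact ⟨x, y, z, hO, hw, hw', hx.trans (by rw [Category.comp_id])⟩

/-- With B = 0 the map c is invertible, so x is determined by `c ≫ x = -d`; y equals e, and z is
given by the anti-commuting square. The same triangle therefore satisfies the bound for every pair
of weights, and the infimum may be taken even when it is not attained. -/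
theorem exists_octahedron_of_isZero {Z : Level0 k C} (hZ : IsZero Z)
    {A X Y E : LevelInf k C} {a : A ⟶ (limitFunctor k C).obj Z}
    {b : (limitFunctor k C).obj Z ⟶ X} {c : X ⟶ A⟦(1 : ℤ)⟧} {d : X ⟶ Y} {e : Y ⟶ E}
    {f : E ⟶ X⟦(1 : ℤ)⟧} (h₁ : Triangle.mk a b c ∈ distTriang (LevelInf k C))
    (h₂ : Triangle.mk d e f ∈ distTriang (LevelInf k C)) :
    ∃ (x : A⟦(1 : ℤ)⟧ ⟶ Y) (y : Y ⟶ E) (z : E ⟶ A⟦(1 : ℤ)⟧⟦(1 : ℤ)⟧),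
      Triangle.mk x y z ∈ distTriang (LevelInf k C) ∧
      OctahedralDiagram a b c d e f (0 : (limitFunctor k C).obj Z ⟶ Y) (𝟙 Y)
        (0 : Y ⟶ ((limitFunctor k C).obj Z)⟦(1 : ℤ)⟧) x y z ∧
      persistenceWeight (Triangle.mk (0 : (limitFunctor k C).obj Z ⟶ Y) (𝟙 Y)
        (0 : Y ⟶ ((limitFunctor k C).obj Z)⟦(1 : ℤ)⟧)) + persistenceWeight (Triangle.mk x y z) ≤
        persistenceWeight (Triangle.mk a b c) + persistenceWeight (Triangle.mk d e f) := by
  obtain ⟨r, hr⟩ := exists_hasWeight h₁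
  obtain ⟨r', hr'⟩ := exists_hasWeight h₂
  obtain ⟨x, y, z, hO, hw, hw', hx⟩ := exists_octahedralDiagram_of_isZero hZ hr hr'
  have hc : IsIso c := (Triangle.isZero₂_iff_isIso₃ _ h₁).1 ((limitFunctor k C).map_isZero hZ)
  have hw₀ := hw.persistenceWeight_le
  rw [ENNReal.ofReal_zero, nonpos_iff_eq_zero] at hw₀
  refine ⟨x, y, z, hw'.distTriang, hO, ?_⟩
  rw [hw₀, zero_add]
  refine persistenceWeight_le_add fun s s' hs hs' => ?_
  obtain ⟨x', y', z', hO', -, hw'', hx'⟩ := exists_octahedralDiagram_of_isZero hZ hs hs'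
  have hxx : x' = x := by rw [← cancel_epi c, hx, hx']
  have hyy : y' = y := by
    rw [← Category.id_comp y', hO'.sq_YE, ← hO.sq_YE, Category.id_comp]
  have hzz : z' = z := neg_injective (hO'.sq_ETTA.symm.trans hO.sq_ETTA)
  rwa [hxx, hyy, hzz] at hw''

end WeightedOctahedron

/-! ## Normalization -/

section Normalization

variable {k : Type w} [Field k] {C : Type u} [PersistenceCategory.{w, v, u} k C]
  [ShiftFunctor k C] [HasZeroObject (Level0 k C)] [HasShift (Level0 k C) ℤ]
  [∀ n : ℤ, (shiftFunctor (Level0 k C) n).Additive] [Pretriangulated (Level0 k C)]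
  [PersistenceTranslation k C]

theorem IsShiftIso.neg {x : ℝ} {A B : LevelInf k C} {e : A ⟶ B} (he : IsShiftIso x e) :
    IsShiftIso x (-e) := by
  have hB : IsIso (-𝟙 B.toLevel0) := ⟨-𝟙 B.toLevel0, by simp, by simp⟩
  have h := (he.comp (IsShiftIso.map_of_isIso (-𝟙 B.toLevel0))).congr_shift (add_zero x)
  rw [Functor.map_neg, CategoryTheory.Functor.map_id] at h
  have h' : e ≫ (-𝟙 B) = -e := by simp
  rw [← h']
  exact h

theorem isShiftIso_of_comp {x : ℝ} {A B D : LevelInf k C} {e : A ⟶ B} {f : B ⟶ D}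
    (he : IsShiftIso 0 e) (h : IsShiftIso x (e ≫ f)) : IsShiftIso x f := by
  have := he.isIso
  have h' := (he.inv.comp h).congr_shift (by rw [neg_zero, zero_add])
  rwa [IsIso.inv_hom_id_assoc] at h'

/-- The corresponding isomorphism of C₀ has an image of shift 0, and differs from this one by
compatibility isomorphisms of shift 0, which are cancelled. -/
theorem isShiftIso_shiftFunctorCompIsoId_hom_app (a b : ℤ) (h : a + b = 0) (A : Level0 k C) :
    IsShiftIso 0 ((shiftFunctorCompIsoId (LevelInf k C) a b h).hom.app
      ((limitFunctor k C).obj A)) := by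
  have h₀ := IsShiftIso.map_of_isIso ((shiftFunctorCompIsoId (Level0 k C) a b h).hom.app A)
  rw [Functor.map_shiftFunctorCompIsoId_hom_app] at h₀
  exact isShiftIso_of_comp ((isShiftIso_commShiftIso_hom_app a A).shift b)
    (isShiftIso_of_comp (isShiftIso_commShiftIso_hom_app b _) h₀)

theorem isShiftIso_shiftFunctorCompIsoId_inv_app (a b : ℤ) (h : a + b = 0) (A : Level0 k C) :
    IsShiftIso 0 ((shiftFunctorCompIsoId (LevelInf k C) a b h).inv.app
      ((limitFunctor k C).obj A)) := by
  have := (isShiftIso_shiftFunctorCompIsoId_hom_app a b h A).inv.congr_shift neg_zero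
  rwa [← NatIso.isIso_inv_app, IsIso.Iso.inv_hom] at this

/-- The triangles `0 ⟶ X ⟶ X ⟶ 0`, up to rotation and isomorphisms of shift `0`. -/
inductive IsContractible : Triangle (LevelInf k C) → Prop
  | zero₁ {Δ : Triangle (LevelInf k C)} (hZ : IsZero Δ.obj₁.toLevel0) (h : IsShiftIso 0 Δ.mor₂) :
      IsContractible Δ
  | zero₂ {Δ : Triangle (LevelInf k C)} (hZ : IsZero Δ.obj₂.toLevel0) (h : IsShiftIso 0 Δ.mor₃) :
      IsContractible Δ
  | zero₃ {Δ : Triangle (LevelInf k C)} (hZ : IsZero Δ.obj₃.toLevel0) (h : IsShiftIso 0 Δ.mor₁) :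
      IsContractible Δ

theorem IsContractible.rotate {Δ : Triangle (LevelInf k C)} (h : IsContractible Δ) :
    IsContractible Δ.rotate := by
  cases h with
  | zero₁ hZ h => exact .zero₃ ((shiftFunctor (Level0 k C) (1 : ℤ)).map_isZero hZ) h
  | zero₂ hZ h => exact .zero₁ hZ h
  | zero₃ hZ h => exact .zero₂ hZ (h.shift 1).neg

/-- Inverse rotation introduces only a sign and the isomorphisms identifying T T^{-1} and T^{-1} T
with the identity; these preserve shift 0. -/
theorem IsContractible.invRotate {Δ : Triangle (LevelInf k C)} (h : IsContractible Δ) :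
    IsContractible Δ.invRotate := by
  cases h with
  | zero₁ hZ h =>
    exact .zero₂ hZ ((h.comp (isShiftIso_shiftFunctorCompIsoId_inv_app (-1) 1 (neg_add_cancel 1)
      Δ.obj₃.toLevel0)).congr_shift (add_zero 0))
  | zero₂ hZ h =>
    exact .zero₃ hZ (((h.shift (-1)).comp (isShiftIso_shiftFunctorCompIsoId_hom_app 1 (-1)
      (add_neg_cancel 1) Δ.obj₁.toLevel0)).congr_shift (add_zero 0)).neg
  | zero₃ hZ h => exact .zero₁ ((shiftFunctor (Level0 k C) (-1 : ℤ)).map_isZero hZ) h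

variable [TriangulatedPersistenceCategory k C]

/-- An exact triangle of C₀ is a model of its image, with identities as comparison maps. -/
theorem hasWeight_zero_of_map {A B X : Level0 k C} {u : A ⟶ B} {v : B ⟶ X} {w : X ⟶ A⟦(1 : ℤ)⟧}
    (h : Triangle.mk u v w ∈ distTriang (Level0 k C))
    {a : (limitFunctor k C).obj A ⟶ (limitFunctor k C).obj B}
    {b : (limitFunctor k C).obj B ⟶ (limitFunctor k C).obj X}
    {c : (limitFunctor k C).obj X ⟶ ((limitFunctor k C).obj A)⟦(1 : ℤ)⟧}
    (ha : (limitFunctor k C).map u = a) (hb : (limitFunctor k C).map v = b)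
    (hc : (limitFunctor k C).map w ≫ ((limitFunctor k C).commShiftIso (1 : ℤ)).hom.app A = c) :
    HasWeight 0 a b c :=
  ⟨le_rfl, 0, 0, le_rfl, le_rfl, neg_zero.le, A, B, X, u, v, w, 𝟙 _, 𝟙 _, 𝟙 _, h, .id _, .id _,
    (IsShiftIso.id _).isShiftRIso, by rw [ha, Category.comp_id, Category.id_comp],
    by rw [hb, Category.comp_id, Category.id_comp], by simp [hc]⟩

theorem hasWeight_zero_of_isZero₁ {A B X : Level0 k C} (hA : IsZero A)
    {a : (limitFunctor k C).obj A ⟶ (limitFunctor k C).obj B}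
    {b : (limitFunctor k C).obj B ⟶ (limitFunctor k C).obj X}
    {c : (limitFunctor k C).obj X ⟶ ((limitFunctor k C).obj A)⟦(1 : ℤ)⟧}
    (h : IsShiftIso 0 b) : HasWeight 0 a b c := by
  obtain ⟨i, rfl⟩ := h.exists_iso
  have hA' := (limitFunctor k C).map_isZero hA
  refine hasWeight_zero_of_map (u := 0) (v := i.hom) (w := 0)
    ((Triangle.distinguished_iff_of_isZero₁ _ hA).2 (inferInstanceAs (IsIso i.hom)))
    (hA'.eq_of_src _ _) rfl
    (((shiftFunctor (LevelInf k C) (1 : ℤ)).map_isZero hA').eq_of_tgt _ _)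

theorem hasWeight_zero_of_isZero₂ {A B X : Level0 k C} (hB : IsZero B)
    {a : (limitFunctor k C).obj A ⟶ (limitFunctor k C).obj B}
    {b : (limitFunctor k C).obj B ⟶ (limitFunctor k C).obj X}
    {c : (limitFunctor k C).obj X ⟶ ((limitFunctor k C).obj A)⟦(1 : ℤ)⟧}
    (h : IsShiftIso 0 c) : HasWeight 0 a b c := by
  obtain ⟨i, hi⟩ := ((h.comp (isShiftIso_commShiftIso_inv_app 1 A)).congr_shift
    (add_zero 0)).exists_iso
  have hB' := (limitFunctor k C).map_isZero hB
  refine hasWeight_zero_of_map (u := 0) (v := 0) (w := i.hom)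
    ((Triangle.distinguished_iff_of_isZero₂ _ hB).2 (inferInstanceAs (IsIso i.hom)))
    (hB'.eq_of_tgt _ _) (hB'.eq_of_src _ _) ?_
  rw [← hi, Category.assoc, Iso.inv_hom_id_app]
  exact Category.comp_id _

theorem hasWeight_zero_of_isZero₃ {A B X : Level0 k C} (hX : IsZero X)
    {a : (limitFunctor k C).obj A ⟶ (limitFunctor k C).obj B}
    {b : (limitFunctor k C).obj B ⟶ (limitFunctor k C).obj X}
    {c : (limitFunctor k C).obj X ⟶ ((limitFunctor k C).obj A)⟦(1 : ℤ)⟧}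
    (h : IsShiftIso 0 a) : HasWeight 0 a b c := by
  obtain ⟨i, rfl⟩ := h.exists_iso
  have hX' := (limitFunctor k C).map_isZero hX
  exact hasWeight_zero_of_map (u := i.hom) (v := 0) (w := 0)
    ((Triangle.distinguished_iff_of_isZero₃ _ hX).2 (inferInstanceAs (IsIso i.hom)))
    rfl (hX'.eq_of_tgt _ _) (hX'.eq_of_src _ _)

theorem IsContractible.persistenceWeight_eq_zero {Δ : Triangle (LevelInf k C)}
    (h : IsContractible Δ) : persistenceWeight Δ = 0 := by
  have hw : HasWeight 0 Δ.mor₁ Δ.mor₂ Δ.mor₃ := by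
    cases h with
    | zero₁ hZ h =>
      exact hasWeight_zero_of_isZero₁ (A := Δ.obj₁.toLevel0) (B := Δ.obj₂.toLevel0)
        (X := Δ.obj₃.toLevel0) hZ h
    | zero₂ hZ h =>
      exact hasWeight_zero_of_isZero₂ (A := Δ.obj₁.toLevel0) (B := Δ.obj₂.toLevel0)
        (X := Δ.obj₃.toLevel0) hZ h
    | zero₃ hZ h =>
      exact hasWeight_zero_of_isZero₃ (A := Δ.obj₁.toLevel0) (B := Δ.obj₂.toLevel0)
        (X := Δ.obj₃.toLevel0) hZ h
  have := hw.persistenceWeight_le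
  rwa [ENNReal.ofReal_zero, nonpos_iff_eq_zero] at this

theorem persistenceWeight_of_isRotationOf {Z : Level0 k C} (hZ : IsZero Z) {X : LevelInf k C}
    {Δ : Triangle (LevelInf k C)}
    (h : IsRotationOf (Triangle.mk (0 : (limitFunctor k C).obj Z ⟶ X) (𝟙 X)
      (0 : X ⟶ ((limitFunctor k C).obj Z)⟦(1 : ℤ)⟧)) Δ) : persistenceWeight Δ = 0 := by
  refine IsContractible.persistenceWeight_eq_zero ?_
  induction h with
  | refl => exact .zero₁ hZ (.id X)
  | rotate _ h => exact h.rotate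
  | invRotate _ h => exact h.invRotate

theorem isTriangularWeight_persistenceWeight {Z : Level0 k C} (hZ : IsZero Z) :
    IsTriangularWeight (persistenceWeight (k := k) (C := C)) 0 ((limitFunctor k C).obj Z) where
  isZero := (limitFunctor k C).map_isZero hZ
  ne_top _ h := persistenceWeight_ne_top h
  octahedral _ _ _ _ _ _ h₁ h₂ _ hε := hasWeightedOctahedron_add h₁ h₂ hε
  le_weight _ _ := zero_le
  weight_rotation _ _ h := persistenceWeight_of_isRotationOf hZ h
  octahedral_zero _ _ _ _ _ _ h₁ h₂ := exists_octahedron_of_isZero hZ h₁ h₂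

end Normalization

/-! ## Subadditivity -/

section Subadditivity

variable {k : Type w} [Field k] {C : Type u} [PersistenceCategory.{w, v, u} k C]
  [ShiftFunctor k C] [HasZeroObject (Level0 k C)] [HasShift (Level0 k C) ℤ]
  [∀ n : ℤ, (shiftFunctor (Level0 k C) n).Additive] [Pretriangulated (Level0 k C)]
  [PersistenceTranslation k C] [TriangulatedPersistenceCategory k C]

theorem IsShiftIso.biprod {A A' B B' S S' : Level0 k C}
    {e : (limitFunctor k C).obj A ⟶ (limitFunctor k C).obj B}
    {f : (limitFunctor k C).obj A' ⟶ (limitFunctor k C).obj B'}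
    (he : IsShiftIso 0 e) (hf : IsShiftIso 0 f)
    {i : A ⟶ S} {p : S ⟶ A} {j : A' ⟶ S} {q : S ⟶ A'} (h : IsBiprod i p j q)
    {i' : B ⟶ S'} {p' : S' ⟶ B} {j' : B' ⟶ S'} {q' : S' ⟶ B'} (h' : IsBiprod i' p' j' q') :
    IsShiftIso 0 (biprodMap ((limitFunctor k C).map p) ((limitFunctor k C).map q)
      ((limitFunctor k C).map i') ((limitFunctor k C).map j') e f) := by
  obtain ⟨φ, hφ, hφ'⟩ := (he.isShiftRIso.biprod hf.isShiftRIso h h').exists_map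
  have := hφ.isIso
  rw [hφ']
  exact .map_of_isIso φ

/-- The contractible triangle on X is added to the model. At the third vertex X must be compared
with the same shift z as E; the identity of X is an r-isomorphism of shift z because -r ≤ z ≤ 0. At
the second vertex the normalized shift 0 lets the identity serve. -/
theorem HasWeight.biprod {r : ℝ} {A B E X S₂ S₃ : Level0 k C}
    {a : (limitFunctor k C).obj A ⟶ (limitFunctor k C).obj B}
    {b : (limitFunctor k C).obj B ⟶ (limitFunctor k C).obj E}
    {c : (limitFunctor k C).obj E ⟶ ((limitFunctor k C).obj A)⟦(1 : ℤ)⟧}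
    (h : HasWeight r a b c)
    {i₂ : X ⟶ S₂} {p₂ : S₂ ⟶ X} {j₂ : B ⟶ S₂} {q₂ : S₂ ⟶ B}
    {i₃ : X ⟶ S₃} {p₃ : S₃ ⟶ X} {j₃ : E ⟶ S₃} {q₃ : S₃ ⟶ E}
    (h₂ : IsBiprod i₂ p₂ j₂ q₂) (h₃ : IsBiprod i₃ p₃ j₃ q₃) :
    HasWeight r (a ≫ (limitFunctor k C).map j₂)
      ((limitFunctor k C).map p₂ ≫ (limitFunctor k C).map i₃ +
        (limitFunctor k C).map q₂ ≫ b ≫ (limitFunctor k C).map j₃)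
      ((limitFunctor k C).map q₃ ≫ c) := by
  obtain ⟨hr, x, z, hx, hz, hrz, A', B', E', u, v, w, e₁, e₂, e₃, hΔ, H₁, H₂, H₃, c₁, c₂, c₃⟩ := h
  have hB := IsBiprod.of_isBilimit (BinaryBiproduct.isBilimit X B')
  have hE := IsBiprod.of_isBilimit (BinaryBiproduct.isBilimit X E')
  have hB' := hB.map (limitFunctor k C)
  have hE' := hE.map (limitFunctor k C)
  refine ⟨hr, x, z, hx, hz, hrz, _, _, _, _, _, _, e₁, _, _,
    distTriang_biprod_left hΔ hB hE, H₁, (IsShiftIso.id _).biprod H₂ hB h₂,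
    (isShiftRIso_id hr hz hrz X).biprod H₃ hE h₃, ?_, ?_, ?_⟩
  · simp only [biprodMap, Functor.map_comp, Preadditive.comp_add, Category.assoc,
      reassoc_of% hB'.inr_fst, reassoc_of% hB'.inr_snd, reassoc_of% c₁, zero_comp, comp_zero,
      zero_add]
  · have k₁ := (h₂.map (limitFunctor k C)).inl_fst
    have k₂ := (h₂.map (limitFunctor k C)).inr_snd
    have k₃ := (h₂.map (limitFunctor k C)).inl_snd
    have k₄ := (h₂.map (limitFunctor k C)).inr_fst
    simp only [biprodMap, Functor.map_comp, Functor.map_add, Preadditive.comp_add,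
      Preadditive.add_comp, Category.assoc, Category.id_comp, reassoc_of% hE'.inl_fst,
      reassoc_of% hE'.inl_snd, reassoc_of% hE'.inr_fst, reassoc_of% hE'.inr_snd,
      reassoc_of% k₁, reassoc_of% k₂, reassoc_of% k₃, reassoc_of% k₄, zero_comp, comp_zero,
      zero_add, add_zero, reassoc_of% c₂]
  · have k₂ := (h₃.map (limitFunctor k C)).inr_snd
    have k₃ := (h₃.map (limitFunctor k C)).inl_snd
    simp only [biprodMap, Functor.map_comp, Preadditive.add_comp, Category.assoc, c₃,
      reassoc_of% k₂, reassoc_of% k₃, zero_comp, comp_zero, zero_add]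

theorem persistenceWeight_biprod_le {A B E X S₂ S₃ : Level0 k C}
    {a : (limitFunctor k C).obj A ⟶ (limitFunctor k C).obj B}
    {b : (limitFunctor k C).obj B ⟶ (limitFunctor k C).obj E}
    {c : (limitFunctor k C).obj E ⟶ ((limitFunctor k C).obj A)⟦(1 : ℤ)⟧}
    (h : Triangle.mk a b c ∈ distTriang (LevelInf k C))
    {i₂ : X ⟶ S₂} {p₂ : S₂ ⟶ X} {j₂ : B ⟶ S₂} {q₂ : S₂ ⟶ B}
    {i₃ : X ⟶ S₃} {p₃ : S₃ ⟶ X} {j₃ : E ⟶ S₃} {q₃ : S₃ ⟶ E}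
    (h₂ : IsBiprod i₂ p₂ j₂ q₂) (h₃ : IsBiprod i₃ p₃ j₃ q₃) {b' : _ ⟶ _}
    (hb' : b' = (limitFunctor k C).map p₂ ≫ (limitFunctor k C).map i₃ +
        (limitFunctor k C).map q₂ ≫ b ≫ (limitFunctor k C).map j₃) :
    Triangle.mk (a ≫ (limitFunctor k C).map j₂) b' ((limitFunctor k C).map q₃ ≫ c) ∈
        distTriang (LevelInf k C) ∧
      persistenceWeight (Triangle.mk (a ≫ (limitFunctor k C).map j₂) b'
        ((limitFunctor k C).map q₃ ≫ c)) ≤ persistenceWeight (Triangle.mk a b c) := by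
  subst hb'
  exact ⟨distTriang_biprod_left h (h₂.map _) (h₃.map _),
    le_persistenceWeight fun r hr => (hr.biprod h₂ h₃).persistenceWeight_le⟩

theorem isSubadditive_persistenceWeight (bp : ∀ A B : Level0 k C, BinaryBiproductData A B) :
    IsSubadditive (persistenceWeight (k := k) (C := C)) (limitBiproducts bp) where
  left {A B E} X _ _ _ h := persistenceWeight_biprod_le (A := A.toLevel0) (B := B.toLevel0)
    (E := E.toLevel0) (X := X.toLevel0) h (.of_isBilimit (bp _ _).isBilimit)
    (.of_isBilimit (bp _ _).isBilimit) rfl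
  -- The same statement with the two summands exchanged.
  right {A B E} X _ _ _ h := persistenceWeight_biprod_le (A := A.toLevel0) (B := B.toLevel0)
    (E := E.toLevel0) (X := X.toLevel0) h (IsBiprod.of_isBilimit (bp _ _).isBilimit).symm
    (IsBiprod.of_isBilimit (bp _ _).isBilimit).symm (add_comm _ _)

end Subadditivity

theorem mainTheorem1 {k : Type w} [Field k] {C : Type u} [PersistenceCategory.{w, v, u} k C]
    [ShiftFunctor k C] [HasZeroObject (Level0 k C)] [HasShift (Level0 k C) ℤ]
    [∀ n : ℤ, (shiftFunctor (Level0 k C) n).Additive] [Pretriangulated (Level0 k C)]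
    [PersistenceTranslation k C] [TriangulatedPersistenceCategory k C] :
    ∃ _ : Pretriangulated (LevelInf k C),
      IsTriangulated (LevelInf k C) ∧
      (limitFunctor k C).IsLocalization (acyclics k C).trW ∧
      distTriang (LevelInf k C) = (limitFunctor k C).essImageDistTriang ∧
      (∀ Z : Level0 k C, IsZero Z →
        IsTriangularWeight (persistenceWeight (k := k) (C := C)) 0
          ((limitFunctor k C).obj Z)) ∧
      (∀ bp : ∀ A B : Level0 k C, BinaryBiproductData A B,
        IsSubadditive (persistenceWeight (k := k) (C := C)) (limitBiproducts bp)) ∧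
      (∀ {A B X Y E : LevelInf k C} (a : A ⟶ B) (b : B ⟶ X) (c : X ⟶ A⟦(1 : ℤ)⟧)
        (d : X ⟶ Y) (e : Y ⟶ E) (f : E ⟶ X⟦(1 : ℤ)⟧),
        Triangle.mk a b c ∈ distTriang (LevelInf k C) →
        Triangle.mk d e f ∈ distTriang (LevelInf k C) →
        WeightIsAttained (Triangle.mk a b c) → WeightIsAttained (Triangle.mk d e f) →
        HasWeightedOctahedron (persistenceWeight (k := k) (C := C)) a b c d e f
          (persistenceWeight (Triangle.mk a b c) + persistenceWeight (Triangle.mk d e f))) := by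
  -- The exact triangles of the localized structure are by definition the essential image of those
  -- of C₀, whence `rfl`.
  exact ⟨inferInstance, inferInstance, inferInstance, rfl,
    fun _ hZ => isTriangularWeight_persistenceWeight hZ, isSubadditive_persistenceWeight,
    fun _ _ _ _ _ _ _ _ h₁ h₂ => hasWeightedOctahedron_of_weightIsAttained h₁ h₂⟩
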